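/- Let $\mathbb{F}$ be $\mathbb{R}$ or $\mathbb{C}$, and let $p,q\in[1,\infty]$ with $p\neq q$. Let $L_p$ be the space of (classes of) $p$-integrable (essentially bounded if $p=\infty$) $\mathbb{F}$-valued functions on $[0,1]$ with Lebesgue measure, and let $L_q(L_p)$ be the Banach space of (classes of) strongly measurable functions $f\colon[0,1]\to L_p$ such that $t\mapsto\|f(t)\|_{L_p}$ has finite $L_q$-norm on $[0,1]$ with Lebesgue measure, with norm $\|f\|=\bigl\|\,\|f(\cdot)\|_{L_p}\bigr\|_{L_q}$. Then $L_q(L_p)$ is complemented in its bidual, that is, there is a bounded linear map $P\colon L_q(L_p)^{**}\to L_q(L_p)$ with $P\circ J=\mathrm{Id}$, where $J\colon L_q(L_p)\to L_q(L_p)^{**}$ is the canonical embedding, if and only if $p<\infty$. -/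

import Mathlib

set_option maxSynthPendingDepth 3

open MeasureTheory
open scoped ENNReal

/-- A normed space `X` is complemented in its bidual: there is a bounded linear map
`P : X** → X` that is a left inverse of the canonical embedding `X → X**`
(equivalently, for a Banach space `X`, the canonical copy of `X` is the range of a bounded
linear projection on `X**`). -/
def IsComplementedInBidual (𝕜 : Type*) [RCLike 𝕜] (X : Type*) [NormedAddCommGroup X]
    [NormedSpace 𝕜 X] : Prop :=
  ∃ P : StrongDual 𝕜 (StrongDual 𝕜 X) →L[𝕜] X,
    ∀ x : X, P (NormedSpace.inclusionInDoubleDual 𝕜 X x) = x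

/-- The mixed-norm Lebesgue space `L_q(L_p)`: classes of strongly measurable functions
`f : [0,1] → L_p([0,1])` for which `t ↦ ‖f t‖_p` has finite `L_q([0,1])` norm, both copies of
`[0,1]` carrying Lebesgue measure. The inner index `p` comes first. -/
abbrev MixedLp (𝕜 : Type*) [RCLike 𝕜] (p q : ℝ≥0∞) [Fact (1 ≤ p)] : Type _ :=
  Lp (Lp 𝕜 p (volume : Measure unitInterval)) q (volume : Measure unitInterval)

open Filter Topology

/-! The two directions are independent.

If p = ∞, then q < ∞ and X = L_q(L_∞) contains a complemented copy of c_0. Take disjoint sets B_n of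
positive measure with indicators e_n, and put u_n(s) = cos(2π(n+1)s) e_n. Disjointness bounds finite
sums ∑ a_n u_n with |a_n| ≤ 1. The functionals Q_n f = 2|B_n|⁻¹ ∫_{B_n} ∫ cos(2π(n+1)s) f(s) ds are
biorthogonal to the u_n, and Q_n f → 0 by the Riemann–Lebesgue lemma and the density of simple
functions in L_q. The series ∑ a_n u_n defines an operator T from ℓ_∞ to X**. A left inverse P of J
would make Q_n ∘ P ∘ T pointwise null on ℓ_∞ and biorthogonal to the unit vectors, which Phillips'
theorem (`not_exists_null_biorthogonal`) excludes.

If p < ∞, an element x of the bidual gives an additive set function on rectangles: apply x to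
integration over the rectangle. Along refining finite partitions that generate the σ-algebra, its
densities form a martingale. Averaging over rectangles is a contraction of L_q(L_p), so by duality
the densities are bounded by ‖x‖ in the mixed norm, hence in L_1. Doob's theorem gives an almost
everywhere limit, and Fatou's lemma puts it in L_q(L_p) with norm at most ‖x‖. The map from x to
this limit is linear, and Lévy's upward theorem shows that it sends J f to f. -/

theorem RCLike.exists_norm_le_one_mul_eq_norm {𝕜 : Type*} [RCLike 𝕜] (z : 𝕜) :
    ∃ a : 𝕜, ‖a‖ ≤ 1 ∧ a * z = (‖z‖ : 𝕜) := by
  obtain ⟨c, hc, hz⟩ := RCLike.exists_norm_eq_mul_self z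
  exact ⟨c, hc.le, hz.symm⟩

/-! ### Weakly unconditionally Cauchy series -/

section WeaklyUnconditionallyCauchy

variable {𝕜 X : Type*} [RCLike 𝕜] [NormedAddCommGroup X] [NormedSpace 𝕜 X]

/-- Coefficients of modulus at most 1 that rotate each φ(u_n) to its absolute value turn the bound
on signed sums into an ℓ_1 bound, uniform in the finite set. -/
theorem sum_norm_dual_apply_le {u : ℕ → X} {C : ℝ}
    (hu : ∀ (F : Finset ℕ) (a : ℕ → 𝕜), (∀ n, ‖a n‖ ≤ 1) → ‖∑ n ∈ F, a n • u n‖ ≤ C)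
    (φ : StrongDual 𝕜 X) (F : Finset ℕ) : ∑ n ∈ F, ‖φ (u n)‖ ≤ C * ‖φ‖ := by
  choose g hg1 hg2 using RCLike.exists_norm_le_one_mul_eq_norm (𝕜 := 𝕜)
  have h := (φ.le_opNorm_of_le (hu F (fun n => g (φ (u n))) fun n => hg1 _))
  have e : φ (∑ n ∈ F, g (φ (u n)) • u n) = ((∑ n ∈ F, ‖φ (u n)‖ : ℝ) : 𝕜) := by
    simp [map_sum, hg2]
  rw [e, RCLike.norm_ofReal, abs_of_nonneg (Finset.sum_nonneg fun _ _ => norm_nonneg _)] at h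
  linarith [mul_comm C ‖φ‖]

theorem summable_norm_dual_apply {u : ℕ → X} {C : ℝ}
    (hu : ∀ (F : Finset ℕ) (a : ℕ → 𝕜), (∀ n, ‖a n‖ ≤ 1) → ‖∑ n ∈ F, a n • u n‖ ≤ C)
    (φ : StrongDual 𝕜 X) : Summable fun n => ‖φ (u n)‖ :=
  summable_of_sum_le (fun _ => norm_nonneg _) (sum_norm_dual_apply_le hu φ)

theorem summable_mul_dual_apply {u : ℕ → X} {C : ℝ}
    (hu : ∀ (F : Finset ℕ) (a : ℕ → 𝕜), (∀ n, ‖a n‖ ≤ 1) → ‖∑ n ∈ F, a n • u n‖ ≤ C)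
    {a : ℕ → 𝕜} {M : ℝ} (ha : ∀ n, ‖a n‖ ≤ M) (φ : StrongDual 𝕜 X) :
    Summable fun n => a n * φ (u n) := by
  refine Summable.of_norm_bounded ((summable_norm_dual_apply hu φ).mul_left M) fun n => ?_
  rw [norm_mul]
  gcongr
  exact ha n

/-- A weakly unconditionally Cauchy series `∑ uₙ` induces an operator `ℓ_∞ → X**`,
`a ↦ ∑ aₙ uₙ`. -/
theorem exists_bidual_sum {u : ℕ → X} {C : ℝ}
    (hu : ∀ (F : Finset ℕ) (a : ℕ → 𝕜), (∀ n, ‖a n‖ ≤ 1) → ‖∑ n ∈ F, a n • u n‖ ≤ C) :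
    ∃ T : BoundedContinuousFunction ℕ 𝕜 →L[𝕜] StrongDual 𝕜 (StrongDual 𝕜 X),
      ∀ a φ, T a φ = ∑' n, a n * φ (u n) := by
  have hs : ∀ (a : BoundedContinuousFunction ℕ 𝕜) (φ : StrongDual 𝕜 X),
      Summable fun n => a n * φ (u n) := fun a φ =>
    summable_mul_dual_apply hu (fun n => a.norm_coe_le_norm n) φ
  let B : BoundedContinuousFunction ℕ 𝕜 →ₗ[𝕜] StrongDual 𝕜 X →ₗ[𝕜] 𝕜 :=
    LinearMap.mk₂ 𝕜 (fun a φ => ∑' n, a n * φ (u n))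
      (fun a b φ => by
        simp only [BoundedContinuousFunction.coe_add, Pi.add_apply, add_mul]
        exact (hs a φ).tsum_add (hs b φ))
      (fun c a φ => by
        simp only [BoundedContinuousFunction.coe_smul, smul_eq_mul, mul_assoc]
        exact tsum_mul_left)
      (fun a φ ψ => by
        simp only [add_apply, mul_add]
        exact (hs a φ).tsum_add (hs a ψ))
      (fun c a φ => by
        simp only [smul_apply, smul_eq_mul, mul_left_comm _ c]
        exact tsum_mul_left)
  refine ⟨LinearMap.mkContinuous₂ B C fun a φ => ?_, fun a φ => rfl⟩
  change ‖∑' n, a n * φ (u n)‖ ≤ _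
  refine (norm_tsum_le_tsum_norm (hs a φ).norm).trans ?_
  refine Real.tsum_le_of_sum_le (fun _ => norm_nonneg _) fun F => ?_
  calc ∑ n ∈ F, ‖a n * φ (u n)‖ ≤ ∑ n ∈ F, ‖a‖ * ‖φ (u n)‖ := by
        refine Finset.sum_le_sum fun n _ => ?_
        rw [norm_mul]
        gcongr
        exact a.norm_coe_le_norm n
    _ = ‖a‖ * ∑ n ∈ F, ‖φ (u n)‖ := by rw [Finset.mul_sum]
    _ ≤ ‖a‖ * (C * ‖φ‖) := by gcongr; exact sum_norm_dual_apply_le hu φ F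
    _ = C * ‖a‖ * ‖φ‖ := by ring

end WeaklyUnconditionallyCauchy

/-! ### Phillips' theorem by an uncountable almost disjoint family -/

section Phillips

/-- The branch of the binary tree along `x`, as a set of codes of finite initial segments. -/
def treeBranch (x : ℕ → Bool) : Set ℕ :=
  Set.range fun n : ℕ => Encodable.encode (List.ofFn fun i : Fin n => x i)

theorem treeBranch_infinite (x : ℕ → Bool) : (treeBranch x).Infinite := by
  refine Set.infinite_range_of_injective fun m n h => ?_
  have := congrArg List.length (Encodable.encode_injective h)
  simpa using this

/-- Initial segments longer than the first k coordinates differ once x and y differ at k, so only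
lengths up to k can be shared. -/
theorem treeBranch_inter_finite {x y : ℕ → Bool} (hxy : x ≠ y) :
    (treeBranch x ∩ treeBranch y).Finite := by
  obtain ⟨k, hk⟩ := Function.ne_iff.1 hxy
  refine ((Set.finite_Iic k).image
    fun n : ℕ => Encodable.encode (List.ofFn fun i : Fin n => x i)).subset ?_
  rintro _ ⟨⟨n, rfl⟩, ⟨m, hm⟩⟩
  refine ⟨n, ?_, rfl⟩
  by_contra hn
  have hn : k < n := not_le.1 hn
  have h := Encodable.encode_injective hm
  have hmn : m = n := by simpa using congrArg List.length h
  subst hmn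
  exact hk (congrFun (List.ofFn_injective h) ⟨k, hn⟩).symm

variable {𝕜 : Type*} [RCLike 𝕜]

/-- The indicator function of a set of natural numbers, as an element of `ℓ_∞`. -/
noncomputable def natIndicator (𝕜 : Type*) [RCLike 𝕜] (A : Set ℕ) :
    BoundedContinuousFunction ℕ 𝕜 :=
  BoundedContinuousFunction.ofNormedAddCommGroupDiscrete (A.indicator fun _ => (1 : 𝕜)) 1
    fun n => by by_cases h : n ∈ A <;> simp [h]

theorem natIndicator_apply (A : Set ℕ) (n : ℕ) :
    natIndicator 𝕜 A n = A.indicator (fun _ => (1 : 𝕜)) n := rfl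

theorem sum_smul_natIndicator_singleton_apply (a : ℕ → 𝕜) (F : Finset ℕ) (m : ℕ) :
    (∑ n ∈ F, a n • natIndicator 𝕜 {n}) m = if m ∈ F then a m else 0 := by
  rw [BoundedContinuousFunction.coe_sum, Finset.sum_apply]
  simp only [BoundedContinuousFunction.coe_smul, natIndicator_apply, Set.indicator_apply,
    Set.mem_singleton_iff, smul_eq_mul, mul_ite, mul_one, mul_zero]
  rw [Finset.sum_ite_eq]

/-- A functional on `ℓ_∞` that vanishes on finitely supported sequences is nonzero on only
countably many members of an almost disjoint family. -/
theorem countable_ne_zero_treeBranch (S : StrongDual 𝕜 (BoundedContinuousFunction ℕ 𝕜))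
    (hS : ∀ n, S (natIndicator 𝕜 {n}) = 0) :
    {x : ℕ → Bool | S (natIndicator 𝕜 (treeBranch x)) ≠ 0}.Countable := by
  have hsum : ∀ G : Finset (ℕ → Bool),
      ∑ x ∈ G, ‖S (natIndicator 𝕜 (treeBranch x))‖ ≤ 1 * ‖S‖ := by
    intro G
    choose g hg1 hg2 using RCLike.exists_norm_le_one_mul_eq_norm (𝕜 := 𝕜)
    set b : (ℕ → Bool) → 𝕜 := fun x => g (S (natIndicator 𝕜 (treeBranch x))) with hb
    set a : BoundedContinuousFunction ℕ 𝕜 := ∑ x ∈ G, b x • natIndicator 𝕜 (treeBranch x)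
      with ha
    have hSa : S a = ((∑ x ∈ G, ‖S (natIndicator 𝕜 (treeBranch x))‖ : ℝ) : 𝕜) := by
      simp [ha, hb, map_sum, hg2]
    -- Off this finite set the branches in G are disjoint, so deleting it from a leaves a sequence
    -- of sup norm at most 1. The deleted part is finitely supported and S does not see it.
    have hfin : (⋃ x ∈ G, ⋃ y ∈ G, ⋃ _ : x ≠ y, treeBranch x ∩ treeBranch y).Finite := by
      refine G.finite_toSet.biUnion fun x _ => G.finite_toSet.biUnion fun y _ => ?_
      exact Set.finite_iUnion fun h => treeBranch_inter_finite h
    set F := hfin.toFinset with hF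
    set a' : BoundedContinuousFunction ℕ 𝕜 := a - ∑ n ∈ F, a n • natIndicator 𝕜 {n} with ha'
    have hSa' : S a' = S a := by simp [ha', map_sum, hS]
    have happ : ∀ n, a' n = if n ∈ F then 0 else a n := by
      intro n
      rw [ha', BoundedContinuousFunction.coe_sub, Pi.sub_apply,
        sum_smul_natIndicator_singleton_apply a F n]
      split_ifs <;> simp
    have hnorm : ‖a'‖ ≤ 1 := by
      rw [BoundedContinuousFunction.norm_le zero_le_one]
      intro n
      rw [happ]
      split_ifs with hn
      · simp
      · rw [ha, BoundedContinuousFunction.coe_sum, Finset.sum_apply]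
        by_cases hex : ∃ x ∈ G, n ∈ treeBranch x
        · obtain ⟨x, hx, hnx⟩ := hex
          rw [Finset.sum_eq_single_of_mem x hx]
          · simpa [natIndicator_apply, hnx] using hg1 _
          · intro y hy hyx
            have : n ∉ treeBranch y := by
              intro hny
              refine hn ?_
              rw [hF, Set.Finite.mem_toFinset]
              simp only [Set.mem_iUnion]
              exact ⟨x, hx, y, hy, hyx.symm, hnx, hny⟩
            simp [natIndicator_apply, this]
        · rw [Finset.sum_eq_zero]
          · simp
          · intro x hx
            have : n ∉ treeBranch x := fun h => hex ⟨x, hx, h⟩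
            simp [natIndicator_apply, this]
    have h := S.le_opNorm_of_le hnorm
    rw [hSa', hSa, RCLike.norm_ofReal,
      abs_of_nonneg (Finset.sum_nonneg fun _ _ => norm_nonneg _)] at h
    linarith
  have := (summable_of_sum_le (fun _ => norm_nonneg _) hsum).countable_support
  refine this.mono fun x hx => ?_
  simpa using hx

/-- **Phillips**: there is no sequence of functionals on `ℓ_∞` that is pointwise null and
biorthogonal to the unit vectors; equivalently, `c_0` is not complemented in `ℓ_∞`. -/
theorem not_exists_null_biorthogonal (ψ : ℕ → StrongDual 𝕜 (BoundedContinuousFunction ℕ 𝕜))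
    (hδ : ∀ n m, ψ n (natIndicator 𝕜 {m}) = if n = m then 1 else 0)
    (hψ : ∀ a, Tendsto (fun n => ψ n a) atTop (𝓝 0)) : False := by
  let δ : ℕ → StrongDual 𝕜 (BoundedContinuousFunction ℕ 𝕜) := fun n =>
    BoundedContinuousFunction.evalCLM 𝕜 n
  have hδe : ∀ n a, δ n a = a n := fun _ _ => rfl
  -- Each evaluation δ n minus ψ n kills the unit vectors, so it sees only countably many branches.
  -- As there are uncountably many, on some branch every ψ n is evaluation at n, which equals 1
  -- infinitely often.
  have hcount : (⋃ n, {x : ℕ → Bool |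
      (δ n - ψ n) (natIndicator 𝕜 (treeBranch x)) ≠ 0}).Countable
      := by
    refine Set.countable_iUnion fun n => countable_ne_zero_treeBranch _ fun m => ?_
    simp [hδ, hδe, natIndicator_apply, Set.indicator_apply]
  have hunc : ¬ (Set.univ : Set (ℕ → Bool)).Countable := by
    rw [Set.countable_univ_iff, not_countable_iff]
    exact Cardinal.aleph0_lt_mk_iff.1 (by simp [Cardinal.aleph0_lt_continuum])
  obtain ⟨x, hx⟩ : ∃ x, x ∉ (⋃ n, {x : ℕ → Bool |
      (δ n - ψ n)
        (natIndicator 𝕜 (treeBranch x)) ≠ 0}) := by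
    by_contra! h
    exact hunc (by rwa [Set.eq_univ_of_forall h] at hcount)
  have hval : ∀ n, ψ n (natIndicator 𝕜 (treeBranch x)) = natIndicator 𝕜 (treeBranch x) n := by
    intro n
    have := not_not.1 fun h => hx (Set.mem_iUnion.2 ⟨n, h⟩)
    exact (sub_eq_zero.1 this).symm
  have hlim := hψ (natIndicator 𝕜 (treeBranch x))
  simp only [hval] at hlim
  have hev := hlim.norm.eventually_lt_const (u := 1) (by simp)
  obtain ⟨N, hN⟩ := eventually_atTop.1 hev
  obtain ⟨n, hn, hNn⟩ := (treeBranch_infinite x).exists_gt N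
  have := hN n hNn.le
  simp [natIndicator_apply, hn] at this

end Phillips

/-- A normed space with a complemented copy of `c_0` is not complemented in its bidual. -/
theorem not_isComplementedInBidual_of_null_biorthogonal {𝕜 X : Type*} [RCLike 𝕜]
    [NormedAddCommGroup X] [NormedSpace 𝕜 X] {u : ℕ → X} {C : ℝ}
    (hu : ∀ (F : Finset ℕ) (a : ℕ → 𝕜), (∀ n, ‖a n‖ ≤ 1) → ‖∑ n ∈ F, a n • u n‖ ≤ C)
    (Q : ℕ → StrongDual 𝕜 X) (hδ : ∀ n m, Q n (u m) = if n = m then 1 else 0)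
    (hQ : ∀ x, Tendsto (fun n => Q n x) atTop (𝓝 0)) : ¬ IsComplementedInBidual 𝕜 X := by
  rintro ⟨P, hP⟩
  obtain ⟨T, hT⟩ := exists_bidual_sum hu
  have hTe : ∀ m, T (natIndicator 𝕜 {m}) = NormedSpace.inclusionInDoubleDual 𝕜 X (u m) := by
    intro m
    ext φ
    rw [hT, NormedSpace.dual_def, tsum_eq_single m]
    · simp [natIndicator_apply]
    · intro n hn
      simp [natIndicator_apply, hn]
  refine not_exists_null_biorthogonal (𝕜 := 𝕜) (fun n => (Q n).comp (P.comp T)) (fun n m => ?_)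
    fun a => hQ _
  simp [hTe, hP, hδ]

/-! ### Bounds and weighted integrals on L_p(E) -/

theorem MeasureTheory.Lp.coeFn_sum_smul {α E 𝕜 ι : Type*} {mα : MeasurableSpace α}
    {μ : Measure α} [NormedAddCommGroup E] [NormedRing 𝕜] [Module 𝕜 E] [IsBoundedSMul 𝕜 E]
    {p : ℝ≥0∞} (F : Finset ι) (a : ι → 𝕜) (f : ι → Lp E p μ) :
    ⇑(∑ i ∈ F, a i • f i) =ᵐ[μ] fun x => ∑ i ∈ F, a i • f i x := by
  classical
  induction F using Finset.induction_on with
  | empty =>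
    simp only [Finset.sum_empty]
    exact Lp.coeFn_zero E p μ
  | insert i F hi ih =>
    rw [Finset.sum_insert hi]
    filter_upwards [Lp.coeFn_add (a i • f i) (∑ i ∈ F, a i • f i), Lp.coeFn_smul (a i) (f i), ih]
      with x h1 h2 h3
    simp only [h1, Pi.add_apply, h2, Pi.smul_apply, h3, Finset.sum_insert hi]

theorem MeasureTheory.Lp.norm_le_of_ae_bound_of_isProbabilityMeasure {α E : Type*}
    {mα : MeasurableSpace α} {μ : Measure α} [IsProbabilityMeasure μ] [NormedAddCommGroup E]
    {p : ℝ≥0∞} {f : Lp E p μ} {C : ℝ} (hC : 0 ≤ C) (h : ∀ᵐ x ∂μ, ‖f x‖ ≤ C) : ‖f‖ ≤ C := by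
  have hμ : measureUnivNNReal μ = 1 := by
    ext; simp [measureUnivNNReal]
  simpa [hμ] using Lp.norm_le_of_ae_bound hC h

theorem MeasureTheory.Lp.integrable_coeFn {α E : Type*} {mα : MeasurableSpace α} {μ : Measure α}
    [IsProbabilityMeasure μ] [NormedAddCommGroup E] {p : ℝ≥0∞} [Fact (1 ≤ p)] (f : Lp E p μ) :
    Integrable f μ :=
  (Lp.memLp f).integrable Fact.out

section WeightedIntegral

variable {α E : Type*} (𝕜 : Type*) [RCLike 𝕜] {mα : MeasurableSpace α} {μ : Measure α}
  [IsProbabilityMeasure μ] [NormedAddCommGroup E] [NormedSpace ℝ E] [NormedSpace 𝕜 E]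
  [SMulCommClass ℝ 𝕜 E] {p : ℝ≥0∞} [Fact (1 ≤ p)]

theorem integrable_weight_smul {g : α → ℝ} (hg : Measurable g) (hg1 : ∀ x, ‖g x‖ ≤ 1)
    (f : Lp E p μ) : Integrable (fun x => g x • f x) μ :=
  (Lp.integrable_coeFn f).bdd_smul 1 hg.aestronglyMeasurable
    (Eventually.of_forall hg1)

theorem norm_integral_weight_smul_le {g : α → ℝ} (hg : Measurable g) (hg1 : ∀ x, ‖g x‖ ≤ 1)
    (f : Lp E p μ) : ‖∫ x, g x • f x ∂μ‖ ≤ ‖f‖ := by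
  calc ‖∫ x, g x • f x ∂μ‖ ≤ ∫ x, ‖g x • f x‖ ∂μ := norm_integral_le_integral_norm _
    _ ≤ ∫ x, ‖f x‖ ∂μ := by
      refine integral_mono (integrable_weight_smul hg hg1 f).norm
        (Lp.integrable_coeFn f).norm fun x => ?_
      simp only [norm_smul]
      exact mul_le_of_le_one_left (norm_nonneg _) (hg1 x)
    _ = (eLpNorm f 1 μ).toReal := by
      rw [eLpNorm_one_eq_lintegral_enorm,
        integral_norm_eq_lintegral_enorm (Lp.aestronglyMeasurable f)]
    _ ≤ (eLpNorm f p μ).toReal := by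
      refine ENNReal.toReal_mono (Lp.eLpNorm_ne_top f) ?_
      exact eLpNorm_le_eLpNorm_of_exponent_le Fact.out (Lp.aestronglyMeasurable f)
    _ = ‖f‖ := (Lp.norm_def f).symm

/-- The operator `f ↦ ∫ g • f` on `L_p(E)`, for a measurable weight `g` with `|g| ≤ 1`. -/
noncomputable def weightedIntegral (g : α → ℝ) (hg : Measurable g) (hg1 : ∀ x, ‖g x‖ ≤ 1) :
    Lp E p μ →L[𝕜] E :=
  LinearMap.mkContinuous
    { toFun := fun f => ∫ x, g x • f x ∂μ
      map_add' := fun f f' => by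
        rw [← integral_add (integrable_weight_smul hg hg1 f) (integrable_weight_smul hg hg1 f')]
        refine integral_congr_ae ?_
        filter_upwards [Lp.coeFn_add f f'] with x hx
        rw [hx, Pi.add_apply, smul_add]
      map_smul' := fun c f => by
        rw [RingHom.id_apply, ← integral_smul]
        refine integral_congr_ae ?_
        filter_upwards [Lp.coeFn_smul c f] with x hx
        rw [hx, Pi.smul_apply, smul_comm] }
    1 fun f => by simpa using norm_integral_weight_smul_le hg hg1 f

theorem weightedIntegral_apply {g : α → ℝ} (hg : Measurable g) (hg1 : ∀ x, ‖g x‖ ≤ 1)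
    (f : Lp E p μ) : weightedIntegral 𝕜 g hg hg1 f = ∫ x, g x • f x ∂μ := rfl

variable {𝕜} in
/-- Weights that are weakly null on indicator functions are weakly null on `L_p(E)`. -/
theorem tendsto_weightedIntegral_zero [CompleteSpace E] (hp : p ≠ ∞) {g : ℕ → α → ℝ}
    (hg : ∀ n, Measurable (g n)) (hg1 : ∀ n x, ‖g n x‖ ≤ 1)
    (h : ∀ A, MeasurableSet A → Tendsto (fun n => ∫ x in A, g n x ∂μ) atTop (𝓝 0))
    (f : Lp E p μ) :
    Tendsto (fun n => weightedIntegral 𝕜 (g n) (hg n) (hg1 n) f) atTop (𝓝 0) := by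
  induction f using Lp.induction (p := p) hp with
  | indicatorConst c hs hμs =>
    rename_i A
    have : ∀ n, weightedIntegral 𝕜 (g n) (hg n) (hg1 n)
        (Lp.simpleFunc.indicatorConst p hs hμs.ne c : Lp E p μ) = (∫ x in A, g n x ∂μ) • c := by
      intro n
      rw [weightedIntegral_apply, Lp.simpleFunc.coe_indicatorConst, ← integral_smul_const,
        ← integral_indicator hs]
      refine integral_congr_ae ?_
      filter_upwards [indicatorConstLp_coeFn (p := p) (hs := hs) (hμs := hμs.ne) (c := c)] with x hx
      rw [hx]
      by_cases hxA : x ∈ A <;> simp [hxA]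
    simp only [this]
    simpa using (h A hs).smul_const c
  | add hf hg _ h1 h2 =>
    simp only [map_add]
    simpa using h1.add h2
  | isClosed =>
    refine isClosed_of_closure_subset fun f hf => ?_
    rw [Set.mem_ofPred_eq, Metric.tendsto_atTop]
    intro ε hε
    obtain ⟨f', hf', hff'⟩ := Metric.mem_closure_iff.1 hf (ε / 2) (half_pos hε)
    obtain ⟨N, hN⟩ := Metric.tendsto_atTop.1 hf' (ε / 2) (half_pos hε)
    refine ⟨N, fun n hn => ?_⟩
    have h1 := hN n hn
    -- All the operators are contractions, so the error f - f' costs less than ε/2 uniformly in n.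
    have h2 := norm_integral_weight_smul_le (hg n) (hg1 n) (f - f')
    rw [← weightedIntegral_apply 𝕜 (hg n) (hg1 n), map_sub] at h2
    rw [dist_eq_norm] at hff'
    rw [dist_zero_right] at h1 ⊢
    calc _ = ‖(weightedIntegral 𝕜 (g n) (hg n) (hg1 n) f -
          weightedIntegral 𝕜 (g n) (hg n) (hg1 n) f') +
          weightedIntegral 𝕜 (g n) (hg n) (hg1 n) f'‖ := by rw [sub_add_cancel]
      _ ≤ _ := norm_add_le _ _
      _ < ε := by linarith

end WeightedIntegral

/-! ### The cosine sequence is weakly null -/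

section CosineSequence

/-- The sequence `cos (2π(n+1)t)` on the unit interval. -/
noncomputable def cosSeq (n : ℕ) (t : unitInterval) : ℝ := Real.cos (2 * Real.pi * (n + 1) * t)

theorem measurable_cosSeq (n : ℕ) : Measurable (cosSeq n) := by
  unfold cosSeq; fun_prop

theorem norm_cosSeq_le (n : ℕ) (t : unitInterval) : ‖cosSeq n t‖ ≤ 1 :=
  Real.abs_cos_le_one _

theorem integral_cosSeq_sq (n : ℕ) : ∫ t, cosSeq n t * cosSeq n t = 1 / 2 := by
  have h := integral_subtype measurableSet_Icc (s := Set.Icc (0 : ℝ) 1)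
    (fun t : ℝ => Real.cos (2 * Real.pi * (n + 1) * t) * Real.cos (2 * Real.pi * (n + 1) * t))
  have hc : 2 * Real.pi * (n + 1) ≠ 0 := by positivity
  refine h.trans ?_
  rw [integral_Icc_eq_integral_Ioc, ← intervalIntegral.integral_of_le zero_le_one,
    intervalIntegral.integral_comp_mul_left (fun t => Real.cos t * Real.cos t) hc]
  simp only [← sq, integral_cos_sq]
  have hs : Real.sin (2 * Real.pi * (n + 1) * 1) = 0 := by
    have := Real.sin_nat_mul_pi (2 * (n + 1))
    push_cast at this
    rw [← this]; ring_nf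
  rw [hs]
  simp
  field_simp

/-- This is the Riemann–Lebesgue lemma: the integral is the real part of the Fourier transform of
the indicator of A at frequency n + 1. -/
theorem tendsto_setIntegral_cosSeq {A : Set unitInterval} (hA : MeasurableSet A) :
    Tendsto (fun n => ∫ t in A, cosSeq n t) atTop (𝓝 0) := by
  set A' : Set ℝ := Subtype.val '' A with hA'
  have hA'm : MeasurableSet A' := measurableSet_Icc.subtype_image hA
  have hRL := Real.tendsto_integral_exp_smul_cocompact (A'.indicator fun _ => (1 : ℂ))
  have hw : Tendsto (fun n : ℕ => (n : ℝ) + 1) atTop (cocompact ℝ) :=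
    (tendsto_atTop_add_const_right _ _ tendsto_natCast_atTop_atTop).mono_right atTop_le_cocompact
  have hre := (Complex.continuous_re.tendsto 0).comp (hRL.comp hw)
  rw [Complex.zero_re] at hre
  refine hre.congr fun n => ?_
  have hfin : volume A' < ∞ :=
    (measure_mono (Subtype.coe_image_subset (Set.Icc (0 : ℝ) 1) A)).trans_lt (by simp)
  have h1 : ∫ t in A, cosSeq n t = ∫ v in A', Real.cos (2 * Real.pi * (n + 1) * v) := by
    have h := unitInterval.measurePreserving_coe.setIntegral_image_emb
      unitInterval.measurableEmbedding_coe (fun v => Real.cos (2 * Real.pi * (n + 1) * v)) A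
    rw [Measure.restrict_restrict hA'm,
      Set.inter_eq_left.2 (Subtype.coe_image_subset (Set.Icc (0 : ℝ) 1) A)] at h
    exact h.symm
  have h2 : ∫ v : ℝ, Real.fourierChar (-(v * ((n : ℝ) + 1))) • A'.indicator (fun _ => (1 : ℂ)) v =
      ∫ v in A', (Real.fourierChar (-(v * ((n : ℝ) + 1))) : ℂ) := by
    rw [← integral_indicator hA'm]
    congr 1 with v
    by_cases hv : v ∈ A' <;> simp [hv, Circle.smul_def]
  have hint : IntegrableOn (fun v : ℝ => (Real.fourierChar (-(v * ((n : ℝ) + 1))) : ℂ)) A' := by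
    refine Measure.integrableOn_of_bounded (M := 1) hfin.ne ?_ ?_
    · exact Continuous.aestronglyMeasurable
        (continuous_subtype_val.comp (Real.continuous_fourierChar.comp (by fun_prop)))
    · exact Eventually.of_forall fun v => (Circle.norm_coe _).le
  simp only [Function.comp_apply]
  rw [h1, h2]
  refine (integral_re (𝕜 := ℂ) hint).symm.trans
    (integral_congr_ae (Eventually.of_forall fun v => ?_))
  change (Real.fourierChar (-(v * ((n : ℝ) + 1))) : ℂ).re = _
  have he : ((2 * Real.pi * -(v * ((n : ℝ) + 1)) : ℝ) : ℂ) * Complex.I =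
      ((-(2 * Real.pi * (n + 1) * v) : ℝ) : ℂ) * Complex.I := by
    congr 2; ring
  rw [Real.fourierChar_apply, he, Complex.exp_ofReal_mul_I_re, Real.cos_neg]

end CosineSequence

/-! ### The case p = ∞: a complemented copy of c_0 -/

theorem exists_pairwise_disjoint_unitInterval : ∃ B : ℕ → Set unitInterval,
    (∀ n, MeasurableSet (B n)) ∧ Pairwise (Function.onFun Disjoint B) ∧
      ∀ n, volume (B n) ≠ 0 := by
  let f : ℕ → unitInterval := fun n => ⟨1 / ((n : ℝ) + 1), by positivity, by
    rw [div_le_one (by positivity)]; linarith [n.cast_nonneg (α := ℝ)]⟩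
  have hf : StrictAnti f := fun m n h => by
    change 1 / ((n : ℝ) + 1) < 1 / ((m : ℝ) + 1)
    gcongr
  refine ⟨fun n => Set.Ioc (f (n + 1)) (f n), fun n => measurableSet_Ioc,
    hf.antitone.pairwise_disjoint_on_Ioc_succ, fun n => ?_⟩
  rw [unitInterval.volume_Ioc]
  simpa using hf n.lt_succ_self

section

variable {α 𝕜 : Type*} [RCLike 𝕜] {mα : MeasurableSpace α} {μ : Measure α}
  [IsProbabilityMeasure μ]

/-- At almost every point at most one term is nonzero. -/
theorem norm_sum_smul_indicatorConstLp_le {p : ℝ≥0∞} {B : ℕ → Set α}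
    (hB : ∀ n, MeasurableSet (B n)) (hd : Pairwise (Function.onFun Disjoint B)) (F : Finset ℕ)
    {a : ℕ → 𝕜} (ha : ∀ n, ‖a n‖ ≤ 1) :
    ‖∑ n ∈ F, a n • indicatorConstLp p (hB n) (measure_ne_top μ _) (1 : 𝕜)‖ ≤ 1 := by
  refine Lp.norm_le_of_ae_bound_of_isProbabilityMeasure zero_le_one ?_
  have h : ∀ᵐ x ∂μ, ∀ n, indicatorConstLp p (hB n) (measure_ne_top μ _) (1 : 𝕜) x =
      (B n).indicator (fun _ => (1 : 𝕜)) x :=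
    ae_all_iff.2 fun n => indicatorConstLp_coeFn
  filter_upwards [h, Lp.coeFn_sum_smul F a
    fun n => indicatorConstLp p (hB n) (measure_ne_top μ _) (1 : 𝕜)] with x hx hsum
  rw [hsum]
  simp only [hx]
  by_cases hex : ∃ n ∈ F, x ∈ B n
  · obtain ⟨n, hn, hxn⟩ := hex
    rw [Finset.sum_eq_single_of_mem n hn]
    · simpa [hxn] using ha n
    · intro m _ hmn
      have : x ∉ B m := fun hxm => Set.disjoint_left.1 (hd hmn) hxm hxn
      simp [this]
  · rw [Finset.sum_eq_zero]
    · simp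
    · intro n hn
      have : x ∉ B n := fun h => hex ⟨n, hn, h⟩
      simp [this]

end

theorem not_isComplementedInBidual_mixedLp_top (𝕜 : Type*) [RCLike 𝕜] (q : ℝ≥0∞)
    [Fact (1 ≤ q)] (hq : q ≠ ∞) : ¬ IsComplementedInBidual 𝕜 (MixedLp 𝕜 ∞ q) := by
  obtain ⟨B, hBm, hBd, hB0⟩ := exists_pairwise_disjoint_unitInterval
  let e : ℕ → Lp 𝕜 ∞ (volume : Measure unitInterval) := fun n =>
    indicatorConstLp ∞ (hBm n) (measure_ne_top _ _) 1
  have he : ∀ (F : Finset ℕ) (a : ℕ → 𝕜), (∀ n, ‖a n‖ ≤ 1) → ‖∑ n ∈ F, a n • e n‖ ≤ 1 :=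
    fun F a ha => norm_sum_smul_indicatorConstLp_le hBm hBd F ha
  have hmem : ∀ n, MemLp (fun s => (cosSeq n s : 𝕜) • e n) q volume := fun n => by
    refine MemLp.of_bound ?_ ‖e n‖ (Eventually.of_forall fun s => ?_)
    · have : Measurable fun s => (cosSeq n s : 𝕜) :=
        RCLike.measurable_ofReal.comp (measurable_cosSeq n)
      exact this.aestronglyMeasurable.smul_const _
    · rw [norm_smul, RCLike.norm_ofReal]
      exact mul_le_of_le_one_left (norm_nonneg _) (norm_cosSeq_le n s)
  let u : ℕ → MixedLp 𝕜 ∞ q := fun n => (hmem n).toLp _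
  let g : ℕ → unitInterval → ℝ := fun n => (B n).indicator 1
  have hg : ∀ n, Measurable (g n) := fun n => measurable_one.indicator (hBm n)
  have hg1 : ∀ n x, ‖g n x‖ ≤ 1 := fun n x => by
    by_cases h : x ∈ B n <;> simp [g, h]
  let W : ℕ → MixedLp 𝕜 ∞ q →L[𝕜] Lp 𝕜 ∞ (volume : Measure unitInterval) := fun n =>
    weightedIntegral 𝕜 (cosSeq n) (measurable_cosSeq n) (norm_cosSeq_le n)
  let V : ℕ → Lp 𝕜 ∞ (volume : Measure unitInterval) →L[𝕜] 𝕜 := fun n =>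
    weightedIntegral 𝕜 (g n) (hg n) (hg1 n)
  have hv : ∀ n, 0 < volume.real (B n) := fun n =>
    ENNReal.toReal_pos (hB0 n) (measure_ne_top _ _)
  have hW : ∀ n m, W n (u m) = (∫ s, cosSeq n s * cosSeq m s) • e m := by
    intro n m
    rw [← integral_smul_const]
    refine integral_congr_ae ?_
    filter_upwards [(hmem m).coeFn_toLp] with s hs
    rw [hs, ← smul_smul, RCLike.real_smul_eq_coe_smul (K := 𝕜) (cosSeq m s)]
  have hVe : ∀ n m, V n (e m) = if n = m then (volume.real (B n) : 𝕜) else 0 := by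
    intro n m
    have h1 : V n (e m) = ∫ t, (B n ∩ B m).indicator (fun _ => (1 : 𝕜)) t := by
      refine integral_congr_ae ?_
      filter_upwards [indicatorConstLp_coeFn (p := ∞) (hs := hBm m)
        (hμs := measure_ne_top volume _) (c := (1 : 𝕜))] with t ht
      rw [ht]
      by_cases h1 : t ∈ B n <;> by_cases h2 : t ∈ B m <;> simp [g, h1, h2]
    rw [h1, integral_indicator_const _ ((hBm n).inter (hBm m))]
    split_ifs with h
    · subst h
      rw [Set.inter_self, RCLike.real_smul_eq_coe_smul (K := 𝕜)]; simp
    · rw [(hBd h).inter_eq]; simp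
  -- The factor |B_n| is available because the inner norm is that of L_∞. It cancels the
  -- normalisation |B_n|⁻¹ below and leaves ‖Q_n x‖ ≤ 2‖W_n x‖.
  have hVn : ∀ n x, ‖V n x‖ ≤ volume.real (B n) * ‖x‖ := by
    intro n x
    have h1 : V n x = ∫ t in B n, x t := by
      rw [← integral_indicator (hBm n)]
      refine integral_congr_ae (Eventually.of_forall fun t => ?_)
      by_cases h1 : t ∈ B n <;> simp [g, h1]
    rw [h1, mul_comm]
    refine norm_setIntegral_le_of_norm_le_const_ae' (measure_lt_top _ _) ?_
    filter_upwards [enorm_ae_le_eLpNormEssSup x volume] with t ht _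
    rw [Lp.norm_def, eLpNorm_exponent_top, ← toReal_enorm]
    exact ENNReal.toReal_mono (by simpa using Lp.eLpNorm_ne_top x) ht
  -- The factor 2 inverts the integral of cos², and |B_n|⁻¹ inverts V_n(e_n). Off the diagonal, the
  -- disjointness of the B_n alone gives 0.
  refine not_isComplementedInBidual_of_null_biorthogonal (u := u) (C := 1) ?_
    (fun n => (2 * (volume.real (B n) : 𝕜)⁻¹) • (V n).comp (W n)) ?_ ?_
  · intro F a ha
    refine Lp.norm_le_of_ae_bound_of_isProbabilityMeasure zero_le_one ?_
    have h : ∀ᵐ s, ∀ n, u n s = (cosSeq n s : 𝕜) • e n :=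
      ae_all_iff.2 fun n => (hmem n).coeFn_toLp
    filter_upwards [h, Lp.coeFn_sum_smul F a u] with s hs hsum
    rw [hsum]
    simp only [hs, smul_smul]
    refine he F _ fun n => ?_
    rw [norm_mul, RCLike.norm_ofReal]
    exact mul_le_one₀ (ha n) (abs_nonneg _) (norm_cosSeq_le n s)
  · intro n m
    rw [smul_apply, ContinuousLinearMap.comp_apply, hW,
      RCLike.real_smul_eq_coe_smul (K := 𝕜), map_smul, hVe]
    split_ifs with h
    · subst h
      rw [integral_cosSeq_sq]
      have : (volume.real (B n) : 𝕜) ≠ 0 := by exact_mod_cast (hv n).ne'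
      simp only [smul_eq_mul]
      push_cast
      field_simp
    · simp
  · intro x
    have hWx : Tendsto (fun n => W n x) atTop (𝓝 0) :=
      tendsto_weightedIntegral_zero hq measurable_cosSeq norm_cosSeq_le
        (fun A hA => tendsto_setIntegral_cosSeq hA) x
    refine squeeze_zero_norm (a := fun n => 2 * ‖W n x‖) (fun n => ?_) ?_
    · rw [smul_apply, ContinuousLinearMap.comp_apply, norm_smul, norm_mul, norm_inv,
        RCLike.norm_ofReal, abs_of_pos (hv n), RCLike.norm_ofNat, mul_assoc]
      gcongr
      rw [inv_mul_le_iff₀ (hv n)]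
      exact hVn n _
    · simpa using hWx.norm.const_mul 2

/-! ### Averages over finite partitions -/

section Cells

variable {α K : Type*} [Fintype K] [MeasurableSpace K] [MeasurableSingletonClass K]
  {mα : MeasurableSpace α} {μ : Measure α}

omit [Fintype K] in
theorem setIntegral_preimage_eq_sum {E : Type*} [NormedAddCommGroup E] [NormedSpace ℝ E]
    {c : α → K} (hc : Measurable c) (B : Finset K) {f : α → E} (hf : Integrable f μ) :
    ∫ x in c ⁻¹' B, f x ∂μ = ∑ k ∈ B, ∫ x in c ⁻¹' {k}, f x ∂μ := by
  have h : c ⁻¹' B = ⋃ k ∈ B, c ⁻¹' {k} := by ext x; simp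
  rw [h, integral_biUnion_finset B (fun k _ => hc (measurableSet_singleton k)) ?_
    fun k _ => hf.integrableOn]
  intro i _ j _ hij
  exact Disjoint.preimage c (by simpa using hij)

variable [IsFiniteMeasure μ]

/-- The function equal to the density `m k / μ (c = k)` on each cell `c = k`. -/
noncomputable def cellDensity {E : Type*} [NormedAddCommGroup E] [NormedSpace ℝ E] (μ : Measure α)
    (c : α → K) (m : K → E) (x : α) : E :=
  (μ.real (c ⁻¹' {c x}))⁻¹ • m (c x)

section

variable {E : Type*} [NormedAddCommGroup E] [NormedSpace ℝ E] {c : α → K}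

omit mα [Fintype K] in
theorem stronglyMeasurable_cellDensity [Countable K] {mα : MeasurableSpace α} (μ : Measure α)
    (c : α → K) (m : K → E) :
    StronglyMeasurable[MeasurableSpace.comap c inferInstance] (cellDensity μ c m) :=
  (StronglyMeasurable.of_discrete (f := fun k => (μ.real (c ⁻¹' {k}))⁻¹ • m k)).comp_measurable
    (comap_measurable c)

theorem integrable_cellDensity (hc : Measurable c) (m : K → E) :
    Integrable (cellDensity μ c m) μ := by
  refine Integrable.of_bound
    ((stronglyMeasurable_cellDensity μ c m).mono hc.comap_le).aestronglyMeasurable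
    (∑ k, ‖(μ.real (c ⁻¹' {k}))⁻¹ • m k‖) (Eventually.of_forall fun x => ?_)
  exact Finset.single_le_sum (f := fun k => ‖(μ.real (c ⁻¹' {k}))⁻¹ • m k‖)
    (fun _ _ => norm_nonneg _) (Finset.mem_univ (c x))

-- On a null cell the inverse in `cellDensity` is 0, so there the mass has to be assumed to vanish.
omit [Fintype K] in
theorem setIntegral_cellDensity [CompleteSpace E] (hc : Measurable c) {m : K → E} {k : K}
    (hm : μ (c ⁻¹' {k}) = 0 → m k = 0) : ∫ x in c ⁻¹' {k}, cellDensity μ c m x ∂μ = m k := by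
  have h1 : ∫ x in c ⁻¹' {k}, cellDensity μ c m x ∂μ =
      ∫ x in c ⁻¹' {k}, (μ.real (c ⁻¹' {k}))⁻¹ • m k ∂μ := by
    refine setIntegral_congr_fun (hc (measurableSet_singleton k)) fun x hx => ?_
    have hx : c x = k := hx
    simp only [cellDensity, hx]
  rw [h1, setIntegral_const, smul_smul]
  by_cases h0 : μ.real (c ⁻¹' {k}) = 0
  · simp [hm ((measureReal_eq_zero_iff (by finiteness)).1 h0)]
  · rw [mul_inv_cancel₀ h0, one_smul]

/-- Conditional expectations with respect to a finite partition are averages over its cells. -/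
theorem cellDensity_ae_eq_condExp [CompleteSpace E] (hc : Measurable c) {f : α → E}
    (hf : Integrable f μ) {m : K → E} (hm : ∀ k, ∫ x in c ⁻¹' {k}, f x ∂μ = m k) :
    cellDensity μ c m =ᵐ[μ] μ[f | MeasurableSpace.comap c inferInstance] := by
  classical
  have hint := integrable_cellDensity (μ := μ) hc m
  refine ae_eq_condExp_of_forall_setIntegral_eq hc.comap_le hf (fun s _ _ => hint.integrableOn) ?_
    (stronglyMeasurable_cellDensity μ c m).aestronglyMeasurable
  rintro _ ⟨B, hB, rfl⟩ -
  -- Every set of the generated σ-algebra is a finite union of cells, so it suffices to compare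
  -- integrals cell by cell.
  have hBf : B = (B.toFinset : Set K) := by simp
  rw [hBf, setIntegral_preimage_eq_sum hc _ hint, setIntegral_preimage_eq_sum hc _ hf]
  refine Finset.sum_congr rfl fun k _ => ?_
  rw [hm, setIntegral_cellDensity hc fun h0 => ?_]
  rw [← hm, Measure.restrict_eq_zero.2 h0, integral_zero_measure]

end

end Cells

/-! ### Cell integrals and indicators on L_p(E) -/

section CellOperators

variable {α E : Type*} (𝕜 : Type*) [RCLike 𝕜] {K : Type*} [Fintype K] [MeasurableSpace K]
  [MeasurableSingletonClass K] {mα : MeasurableSpace α} {μ : Measure α} [IsProbabilityMeasure μ]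
  [NormedAddCommGroup E] [NormedSpace ℝ E] [NormedSpace 𝕜 E] [SMulCommClass ℝ 𝕜 E] {p : ℝ≥0∞}
  [Fact (1 ≤ p)]

/-- Integration over the cell `c = k`, as an operator on `L_p(E)`. -/
noncomputable def cellIntegral {c : α → K} (hc : Measurable c) (k : K) : Lp E p μ →L[𝕜] E :=
  weightedIntegral 𝕜 ((c ⁻¹' {k}).indicator 1)
    (measurable_one.indicator (hc (measurableSet_singleton k)))
    fun x => by by_cases h : x ∈ c ⁻¹' {k} <;> simp [h]

omit [Fintype K] in
theorem cellIntegral_apply {c : α → K} (hc : Measurable c) (k : K) (f : Lp E p μ) :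
    cellIntegral 𝕜 hc k f = ∫ x in c ⁻¹' {k}, f x ∂μ := by
  rw [cellIntegral, weightedIntegral_apply, ← integral_indicator (hc (measurableSet_singleton k))]
  congr 1 with x
  by_cases h : x ∈ c ⁻¹' {k} <;> simp [h]

-- Cell averages are conditional expectations, which contract the L_p norm for vector values too.
-- The vector-valued form serves both the outer and the inner variable of L_q(L_p).
omit [NormedSpace 𝕜 E] [SMulCommClass ℝ 𝕜 E] in
theorem norm_le_of_ae_norm_le_cell_average {E' : Type*} [NormedAddCommGroup E'] [CompleteSpace E]
    {c : α → K} (hc : Measurable c) (f : Lp E p μ) (F : Lp E' p μ)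
    (h : ∀ᵐ x ∂μ, ‖F x‖ ≤ ‖(μ.real (c ⁻¹' {c x}))⁻¹ • ∫ y in c ⁻¹' {c x}, f y ∂μ‖) :
    ‖F‖ ≤ ‖f‖ := by
  rw [Lp.norm_def, Lp.norm_def]
  refine ENNReal.toReal_mono (Lp.eLpNorm_ne_top f) ?_
  refine le_trans ?_ (eLpNorm_condExp_le_eLpNorm (m := MeasurableSpace.comap c inferInstance)
    (μ := μ) f (p := p) Fact.out)
  refine eLpNorm_mono_ae ?_
  filter_upwards [h, cellDensity_ae_eq_condExp hc (Lp.integrable_coeFn f) fun k => rfl]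
    with x hx hx2
  rwa [← hx2]

variable {𝕜}

/-- The indicator function of the cell `c = k` times a vector. -/
noncomputable def cellIndicator (p : ℝ≥0∞) (μ : Measure α) [IsProbabilityMeasure μ] {c : α → K}
    (hc : Measurable c) (k : K) (v : E) : Lp E p μ :=
  indicatorConstLp p (hc (measurableSet_singleton k)) (measure_ne_top μ _) v

omit [Fintype K] [Fact (1 ≤ p)] [NormedSpace ℝ E] [NormedSpace 𝕜 E] [SMulCommClass ℝ 𝕜 E] in
theorem cellIndicator_coeFn [Countable K] [DecidableEq K] {c : α → K} (hc : Measurable c)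
    (v : K → E) :
    ∀ᵐ x ∂μ, ∀ k, cellIndicator p μ hc k (v k) x = if c x = k then v k else 0 := by
  refine ae_all_iff.2 fun k => ?_
  filter_upwards [indicatorConstLp_coeFn (p := p) (hs := hc (measurableSet_singleton k))
    (hμs := measure_ne_top μ _) (c := v k)] with x hx
  rw [cellIndicator, hx]
  by_cases h : c x = k <;> simp [h]

omit [NormedSpace ℝ E] [SMulCommClass ℝ 𝕜 E] [Fact (1 ≤ p)] in
theorem sum_cellIndicator_coeFn {c : α → K} (hc : Measurable c) (a : K → 𝕜) (v : K → E) :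
    ∀ᵐ x ∂μ, (∑ k, a k • cellIndicator p μ hc k (v k)) x = a (c x) • v (c x) := by
  classical
  filter_upwards [cellIndicator_coeFn hc v,
    Lp.coeFn_sum_smul Finset.univ a fun k => cellIndicator p μ hc k (v k)] with x hx hsum
  rw [hsum, Finset.sum_eq_single (c x)]
  · rw [hx, if_pos rfl]
  · intro k _ hk
    rw [hx, if_neg hk.symm, smul_zero]
  · simp

end CellOperators

/-! ### Rectangle averages and densities of bidual elements -/

section Mixed

variable {α β 𝕜 K L : Type*} [RCLike 𝕜] [Fintype K] [MeasurableSpace K]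
  [MeasurableSingletonClass K] [Fintype L] [MeasurableSpace L] [MeasurableSingletonClass L]
  {mα : MeasurableSpace α} {mβ : MeasurableSpace β} (μ : Measure α) (ν : Measure β)
  [IsProbabilityMeasure μ] [IsProbabilityMeasure ν] (p q : ℝ≥0∞) [Fact (1 ≤ p)] [Fact (1 ≤ q)]

/-- Integration over the rectangle `c = k, d = l`, as a functional on `L_q(L_p)`. -/
noncomputable def rectIntegral (𝕜 : Type*) [RCLike 𝕜] {c : α → K} (hc : Measurable c) {d : β → L}
    (hd : Measurable d) (k : K) (l : L) : StrongDual 𝕜 (Lp (Lp 𝕜 p ν) q μ) :=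
  (cellIntegral 𝕜 hd l).comp (cellIntegral 𝕜 hc k)

/-- The indicator function of the rectangle `c = k, d = l`, as an element of `L_q(L_p)`. -/
noncomputable def rectIndicator (𝕜 : Type*) [RCLike 𝕜] {c : α → K} (hc : Measurable c) {d : β → L}
    (hd : Measurable d) (k : K) (l : L) : Lp (Lp 𝕜 p ν) q μ :=
  cellIndicator q μ hc k (cellIndicator p ν hd l 1)

variable {μ ν p q}

omit [Fact (1 ≤ q)] in
theorem sum_rectIndicator_coeFn {c : α → K} (hc : Measurable c) {d : β → L}
    (hd : Measurable d) (a : K → L → 𝕜) :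
    ∀ᵐ s ∂μ, (∑ k, ∑ l, a k l • rectIndicator μ ν p q 𝕜 hc hd k l) s =
      ∑ l, a (c s) l • cellIndicator p ν hd l (1 : 𝕜) := by
  classical
  have h : ∀ᵐ s ∂μ, ∀ l k, rectIndicator μ ν p q 𝕜 hc hd k l s =
      if c s = k then cellIndicator p ν hd l (1 : 𝕜) else 0 :=
    ae_all_iff.2 fun l => cellIndicator_coeFn hc fun _ => cellIndicator p ν hd l (1 : 𝕜)
  rw [← Fintype.sum_prod_type']
  filter_upwards [h, Lp.coeFn_sum_smul Finset.univ (fun i : K × L => a i.1 i.2)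
    fun i => rectIndicator μ ν p q 𝕜 hc hd i.1 i.2] with s hs hsum
  rw [hsum, Fintype.sum_prod_type, Finset.sum_eq_single (c s)]
  · simp [hs]
  · intro k _ hk
    simp [hs, hk.symm]
  · simp

/-- Averaging over finitely many rectangles is a contraction on `L_q(L_p)`. -/
theorem norm_rect_average_le {c : α → K} (hc : Measurable c) {d : β → L} (hd : Measurable d)
    (f : Lp (Lp 𝕜 p ν) q μ) :
    ‖∑ k, ∑ l, ((((μ.real (c ⁻¹' {k}))⁻¹ * (ν.real (d ⁻¹' {l}))⁻¹ : ℝ) : 𝕜) *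
      rectIntegral μ ν p q 𝕜 hc hd k l f) • rectIndicator μ ν p q 𝕜 hc hd k l‖ ≤ ‖f‖ := by
  refine norm_le_of_ae_norm_le_cell_average hc f _ ?_
  filter_upwards [sum_rectIndicator_coeFn (μ := μ) (ν := ν) (p := p) (q := q) hc hd fun k l =>
    (((μ.real (c ⁻¹' {k}))⁻¹ * (ν.real (d ⁻¹' {l}))⁻¹ : ℝ) : 𝕜) *
      rectIntegral μ ν p q 𝕜 hc hd k l f] with s hs
  rw [hs]
  -- For fixed s, the value of the rectangle average is the average over the cells of d of the
  -- vector r • ∫ f in L_p, so the same contraction applies once more.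
  set r : ℝ := (μ.real (c ⁻¹' {c s}))⁻¹ with hr
  refine norm_le_of_ae_norm_le_cell_average hd (r • ∫ y in c ⁻¹' {c s}, f y ∂μ) _ ?_
  filter_upwards [sum_cellIndicator_coeFn (p := p) (μ := ν) hd (fun l =>
    (((μ.real (c ⁻¹' {c s}))⁻¹ * (ν.real (d ⁻¹' {l}))⁻¹ : ℝ) : 𝕜) *
      rectIntegral μ ν p q 𝕜 hc hd (c s) l f) (fun _ => (1 : 𝕜))] with t ht
  rw [ht]
  rw [← cellIntegral_apply 𝕜 hc, ← cellIntegral_apply 𝕜 hd,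
    RCLike.real_smul_eq_coe_smul (K := 𝕜) (E := Lp 𝕜 p ν), map_smul, rectIntegral,
    ContinuousLinearMap.comp_apply]
  refine le_of_eq ?_
  simp only [norm_smul, norm_mul, RCLike.norm_ofReal, ← hr, norm_one, abs_mul, Real.norm_eq_abs]
  ring

variable (μ ν p q) in
/-- The density on the rectangle `c = k, d = l` of the finitely additive measure represented by a
bidual element. -/
noncomputable def rectDensity {c : α → K} (hc : Measurable c) {d : β → L} (hd : Measurable d)
    (x : StrongDual 𝕜 (StrongDual 𝕜 (Lp (Lp 𝕜 p ν) q μ))) (k : K) (l : L) : 𝕜 :=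
  (((μ.real (c ⁻¹' {k}))⁻¹ * (ν.real (d ⁻¹' {l}))⁻¹ : ℝ) : 𝕜) *
    x (rectIntegral μ ν p q 𝕜 hc hd k l)

theorem norm_sum_rectDensity_le {c : α → K} (hc : Measurable c) {d : β → L} (hd : Measurable d)
    (x : StrongDual 𝕜 (StrongDual 𝕜 (Lp (Lp 𝕜 p ν) q μ))) :
    ‖∑ k, ∑ l, rectDensity μ ν p q hc hd x k l • rectIndicator μ ν p q 𝕜 hc hd k l‖ ≤ ‖x‖ := by
  refine NormedSpace.norm_le_dual_bound 𝕜 _ (norm_nonneg x) fun ψ => ?_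
  -- Φ is ψ composed with the averaging contraction. Pairing ψ with the density of x amounts to
  -- applying x to Φ.
  set Φ : StrongDual 𝕜 (Lp (Lp 𝕜 p ν) q μ) := ∑ k, ∑ l,
    ((((μ.real (c ⁻¹' {k}))⁻¹ * (ν.real (d ⁻¹' {l}))⁻¹ : ℝ) : 𝕜) *
      ψ (rectIndicator μ ν p q 𝕜 hc hd k l)) • rectIntegral μ ν p q 𝕜 hc hd k l with hΦ
  have hΦn : ‖Φ‖ ≤ ‖ψ‖ := by
    refine ContinuousLinearMap.opNorm_le_bound _ (norm_nonneg _) fun f => ?_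
    refine le_trans (le_of_eq ?_) (ψ.le_opNorm_of_le (norm_rect_average_le hc hd f))
    congr 1
    simp only [hΦ, map_sum, map_smul, sum_apply, smul_apply, smul_eq_mul]
    refine Finset.sum_congr rfl fun k _ => Finset.sum_congr rfl fun l _ => ?_
    ring
  refine le_trans (le_of_eq ?_) (x.le_opNorm_of_le hΦn)
  congr 1
  simp only [hΦ, map_sum, map_smul, smul_eq_mul, rectDensity]
  refine Finset.sum_congr rfl fun k _ => Finset.sum_congr rfl fun l _ => ?_
  ring

theorem eLpNorm_eLpNorm_rectDensity_le {c : α → K} (hc : Measurable c) {d : β → L}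
    (hd : Measurable d) (x : StrongDual 𝕜 (StrongDual 𝕜 (Lp (Lp 𝕜 p ν) q μ))) :
    eLpNorm (fun s => eLpNorm (fun t => rectDensity μ ν p q hc hd x (c s) (d t)) p ν) q μ ≤
      ‖x‖ₑ := by
  set h := ∑ k, ∑ l, rectDensity μ ν p q hc hd x k l • rectIndicator μ ν p q 𝕜 hc hd k l with hh
  have h1 : (fun s => eLpNorm (fun t => rectDensity μ ν p q hc hd x (c s) (d t)) p ν) =ᵐ[μ]
      fun s => ‖h s‖ₑ := by
    filter_upwards [sum_rectIndicator_coeFn (q := q) (p := p) (ν := ν) (μ := μ) hc hd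
      fun k l => rectDensity μ ν p q hc hd x k l] with s hs
    rw [hh, hs, Lp.enorm_def]
    refine eLpNorm_congr_ae ?_
    filter_upwards [sum_cellIndicator_coeFn (p := p) (μ := ν) hd (fun l =>
      rectDensity μ ν p q hc hd x (c s) l) (fun _ => (1 : 𝕜))] with t ht
    rw [ht, smul_eq_mul, mul_one]
  rw [eLpNorm_congr_ae h1, eLpNorm_enorm, ← Lp.enorm_def]
  exact enorm_le_iff_norm_le.2 (norm_sum_rectDensity_le hc hd x)

end Mixed

/-! ### Martingales along refining partitions -/

section Refining

variable {γ : Type*} {mγ : MeasurableSpace γ} {K : ℕ → Type*} [∀ n, Fintype (K n)]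
  [∀ n, DecidableEq (K n)] [∀ n, MeasurableSpace (K n)] [∀ n, MeasurableSingletonClass (K n)]

omit [∀ n, DecidableEq (K n)] in
/-- The filtration generated by a refining sequence of finite partitions. -/
def cellFiltration (c : ∀ n, γ → K n) (hc : ∀ n, Measurable (c n)) (π : ∀ n, K (n + 1) → K n)
    (hπ : ∀ n x, π n (c (n + 1) x) = c n x) : Filtration ℕ mγ where
  seq n := MeasurableSpace.comap (c n) inferInstance
  mono' := monotone_nat_of_le_succ fun n => by
    have h : c n = π n ∘ c (n + 1) := funext fun x => (hπ n x).symm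
    rw [h, ← MeasurableSpace.comap_comp]
    exact MeasurableSpace.comap_mono (Measurable.of_discrete (f := π n)).comap_le
  le' n := (hc n).comap_le

variable {μ : Measure γ} [IsFiniteMeasure μ] {c : ∀ n, γ → K n} {π : ∀ n, K (n + 1) → K n}

/-- Additivity of the masses under refinement is the martingale property: consecutive densities have
equal integrals over each coarser cell. -/
theorem martingale_cellDensity (hc : ∀ n, Measurable (c n))
    (hπ : ∀ n x, π n (c (n + 1) x) = c n x) {m : ∀ n, K n → ℝ}
    (hm : ∀ n k, m n k = ∑ k' with π n k' = k, m (n + 1) k')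
    (h0 : ∀ n k, μ (c n ⁻¹' {k}) = 0 → m n k = 0) :
    Martingale (fun n => cellDensity μ (c n) (m n)) (cellFiltration c hc π hπ) μ := by
  refine martingale_nat (fun n => stronglyMeasurable_cellDensity μ (c n) (m n))
    (fun n => integrable_cellDensity (hc n) (m n)) fun n => ?_
  refine cellDensity_ae_eq_condExp (hc n) (integrable_cellDensity (hc (n + 1)) (m (n + 1)))
    fun k => ?_
  have h : c n ⁻¹' {k} = c (n + 1) ⁻¹' (Finset.univ.filter fun k' => π n k' = k : Finset _) := by
    ext x; simp [hπ]
  rw [h, setIntegral_preimage_eq_sum (hc (n + 1)) _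
    (integrable_cellDensity (hc (n + 1)) (m (n + 1))), hm]
  exact Finset.sum_congr rfl fun k' _ => setIntegral_cellDensity (hc (n + 1)) (h0 (n + 1) k')

theorem exists_tendsto_cellDensity_real (hc : ∀ n, Measurable (c n))
    (hπ : ∀ n x, π n (c (n + 1) x) = c n x) {m : ∀ n, K n → ℝ}
    (hm : ∀ n k, m n k = ∑ k' with π n k' = k, m (n + 1) k')
    (h0 : ∀ n k, μ (c n ⁻¹' {k}) = 0 → m n k = 0) {R : NNReal}
    (hR : ∀ n, eLpNorm (cellDensity μ (c n) (m n)) 1 μ ≤ R) :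
    ∃ h : γ → ℝ, Measurable h ∧
      ∀ᵐ x ∂μ, Tendsto (fun n => cellDensity μ (c n) (m n) x) atTop (𝓝 (h x)) :=
  measurable_limit_of_tendsto_metrizable_ae
    (fun n => (integrable_cellDensity (hc n) (m n)).aemeasurable)
    ((martingale_cellDensity hc hπ hm h0).submartingale.exists_ae_tendsto_of_bdd hR)

omit [IsFiniteMeasure μ] in
theorem re_cellDensity {𝕜 K : Type*} [RCLike 𝕜] (c : γ → K) (m : K → 𝕜) (x : γ) :
    RCLike.re (cellDensity μ c m x) = cellDensity μ c (fun k => RCLike.re (m k)) x := by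
  simp [cellDensity, RCLike.smul_re]

omit [IsFiniteMeasure μ] in
theorem im_cellDensity {𝕜 K : Type*} [RCLike 𝕜] (c : γ → K) (m : K → 𝕜) (x : γ) :
    RCLike.im (cellDensity μ c m x) = cellDensity μ c (fun k => RCLike.im (m k)) x := by
  simp [cellDensity, RCLike.smul_im]

variable {𝕜 : Type*} [RCLike 𝕜]

theorem tendsto_of_tendsto_re_im {u : ℕ → 𝕜} {z : 𝕜}
    (hre : Tendsto (fun n => RCLike.re (u n)) atTop (𝓝 (RCLike.re z)))
    (him : Tendsto (fun n => RCLike.im (u n)) atTop (𝓝 (RCLike.im z))) :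
    Tendsto u atTop (𝓝 z) := by
  have h := ((RCLike.continuous_ofReal (K := 𝕜)).tendsto _ |>.comp hre).add
    (((RCLike.continuous_ofReal (K := 𝕜)).tendsto _ |>.comp him).mul_const RCLike.I)
  simpa [Function.comp_def, RCLike.re_add_im] using h

/-- The densities of an additive set function on a refining sequence of finite partitions converge
almost everywhere if they are bounded in `L₁`. -/
theorem exists_tendsto_cellDensity (hc : ∀ n, Measurable (c n))
    (hπ : ∀ n x, π n (c (n + 1) x) = c n x) {m : ∀ n, K n → 𝕜}
    (hm : ∀ n k, m n k = ∑ k' with π n k' = k, m (n + 1) k')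
    (h0 : ∀ n k, μ (c n ⁻¹' {k}) = 0 → m n k = 0) {R : NNReal}
    (hR : ∀ n, eLpNorm (cellDensity μ (c n) (m n)) 1 μ ≤ R) :
    ∃ h : γ → 𝕜, Measurable h ∧
      ∀ᵐ x ∂μ, Tendsto (fun n => cellDensity μ (c n) (m n) x) atTop (𝓝 (h x)) := by
  obtain ⟨h1, h1m, h1t⟩ := exists_tendsto_cellDensity_real (μ := μ) hc hπ
    (m := fun n k => RCLike.re (m n k)) (R := R) (fun n k => by rw [hm, map_sum])
    (fun n k h => by rw [h0 n k h, map_zero]) fun n => by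
      refine (eLpNorm_mono fun x => ?_).trans (hR n)
      rw [← re_cellDensity]
      exact RCLike.norm_re_le_norm _
  obtain ⟨h2, h2m, h2t⟩ := exists_tendsto_cellDensity_real (μ := μ) hc hπ
    (m := fun n k => RCLike.im (m n k)) (R := R) (fun n k => by rw [hm, map_sum])
    (fun n k h => by rw [h0 n k h, map_zero]) fun n => by
      refine (eLpNorm_mono fun x => ?_).trans (hR n)
      rw [← im_cellDensity]
      exact RCLike.norm_im_le_norm _
  refine ⟨fun x => h1 x + h2 x * RCLike.I, ?_, ?_⟩
  · exact (RCLike.measurable_ofReal.comp h1m).add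
      ((RCLike.measurable_ofReal.comp h2m).mul_const _)
  · filter_upwards [h1t, h2t] with x hx1 hx2
    simp only [← re_cellDensity, ← im_cellDensity] at hx1 hx2
    have h := ((RCLike.continuous_ofReal (K := 𝕜)).tendsto _ |>.comp hx1).add
      (((RCLike.continuous_ofReal (K := 𝕜)).tendsto _ |>.comp hx2).mul_const RCLike.I)
    simpa only [Function.comp_def, RCLike.re_add_im] using h

omit [∀ n, DecidableEq (K n)] in
theorem tendsto_cellDensity_of_integral_real (hc : ∀ n, Measurable (c n))
    (hπ : ∀ n x, π n (c (n + 1) x) = c n x)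
    (hsup : ⨆ n, MeasurableSpace.comap (c n) inferInstance = mγ) {f : γ → ℝ} (hf : Integrable f μ)
    {m : ∀ n, K n → ℝ}
    (hm : ∀ n k, ∫ x in c n ⁻¹' {k}, f x ∂μ = m n k) :
    ∀ᵐ x ∂μ, Tendsto (fun n => cellDensity μ (c n) (m n) x) atTop (𝓝 (f x)) := by
  have h1 := tendsto_ae_condExp (μ := μ) (ℱ := cellFiltration c hc π hπ) f
  have h2 : ∀ᵐ x ∂μ, ∀ n, cellDensity μ (c n) (m n) x = (μ[f | cellFiltration c hc π hπ n]) x :=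
    ae_all_iff.2 fun n => cellDensity_ae_eq_condExp (hc n) hf (hm n)
  have h3 : μ[f | ⨆ n, cellFiltration c hc π hπ n] =ᵐ[μ] f := by
    have : (⨆ n, cellFiltration c hc π hπ n : MeasurableSpace γ) = mγ := hsup
    rw [this]
    exact condExp_of_aestronglyMeasurable' le_rfl hf.aestronglyMeasurable hf
  filter_upwards [h1, h2, h3] with x hx1 hx2 hx3
  simpa only [hx2, ← hx3] using hx1

omit [∀ n, DecidableEq (K n)] in
/-- **Lévy's upward theorem** for averages over a generating refining sequence of finite
partitions. -/
theorem tendsto_cellDensity_of_integral (hc : ∀ n, Measurable (c n))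
    (hπ : ∀ n x, π n (c (n + 1) x) = c n x)
    (hsup : ⨆ n, MeasurableSpace.comap (c n) inferInstance = mγ) {f : γ → 𝕜} (hf : Integrable f μ)
    {m : ∀ n, K n → 𝕜}
    (hm : ∀ n k, ∫ x in c n ⁻¹' {k}, f x ∂μ = m n k) :
    ∀ᵐ x ∂μ, Tendsto (fun n => cellDensity μ (c n) (m n) x) atTop (𝓝 (f x)) := by
  have h1 := tendsto_cellDensity_of_integral_real hc hπ hsup hf.re
    (m := fun n k => RCLike.re (m n k)) fun n k => by rw [integral_re hf.integrableOn, hm]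
  have h2 := tendsto_cellDensity_of_integral_real hc hπ hsup hf.im
    (m := fun n k => RCLike.im (m n k)) fun n k => by rw [integral_im hf.integrableOn, hm]
  filter_upwards [h1, h2] with x hx1 hx2
  simp only [← re_cellDensity, ← im_cellDensity] at hx1 hx2
  exact tendsto_of_tendsto_re_im hx1 hx2

end Refining

/-! ### Refining partitions that generate a product σ-algebra -/

section BinaryCode

open MeasurableSpace

variable {α : Type*} [mα : MeasurableSpace α] [CountablyGenerated α]

open Classical in
/-- The code of a point recording to which of the first `n` sets of a generating sequence it
belongs. -/
noncomputable def binaryCode (n : ℕ) (a : α) (i : Fin n) : Bool :=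
  decide (a ∈ natGeneratingSequence α i)

theorem measurable_binaryCode (n : ℕ) : Measurable (binaryCode n : α → Fin n → Bool) := by
  refine measurable_pi_lambda _ fun i => measurable_to_bool ?_
  have : (fun a : α => binaryCode n a i) ⁻¹' {true} = natGeneratingSequence α i := by
    ext a; simp [binaryCode]
  rw [this]
  exact measurableSet_natGeneratingSequence _

theorem le_iSup_comap_binaryCode :
    mα ≤ ⨆ n, MeasurableSpace.comap (binaryCode n : α → Fin n → Bool) inferInstance := by
  conv_lhs => rw [← generateFrom_natGeneratingSequence α]
  refine generateFrom_le ?_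
  rintro _ ⟨n, rfl⟩
  -- The n-th generating set is first recorded by the code of length n + 1, as its last digit.
  refine le_iSup (fun n => MeasurableSpace.comap (binaryCode n : α → Fin n → Bool) inferInstance)
    (n + 1) _ ⟨{k | k (Fin.last n) = true}, Set.Finite.measurableSet (Set.toFinite _), ?_⟩
  ext a; simp [binaryCode]

variable {β : Type*} [mβ : MeasurableSpace β] [CountablyGenerated β]

/-- The pair of codes of the coordinates of a point in a product. -/
noncomputable def binaryCodeProd (n : ℕ) (z : α × β) : (Fin n → Bool) × (Fin n → Bool) :=
  (binaryCode n z.1, binaryCode n z.2)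

theorem measurable_binaryCodeProd (n : ℕ) :
    Measurable (binaryCodeProd n : α × β → (Fin n → Bool) × (Fin n → Bool)) :=
  ((measurable_binaryCode n).comp measurable_fst).prodMk
    ((measurable_binaryCode n).comp measurable_snd)

/-- Truncation of codes. -/
def truncProd (n : ℕ) (k : (Fin (n + 1) → Bool) × (Fin (n + 1) → Bool)) :
    (Fin n → Bool) × (Fin n → Bool) :=
  (fun i => k.1 i.castSucc, fun i => k.2 i.castSucc)

theorem truncProd_binaryCodeProd (n : ℕ) (z : α × β) :
    truncProd n (binaryCodeProd (n + 1) z) = binaryCodeProd n z := rfl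

theorem iSup_comap_binaryCodeProd :
    ⨆ n, MeasurableSpace.comap
      (binaryCodeProd n : α × β → (Fin n → Bool) × (Fin n → Bool)) inferInstance =
      (inferInstance : MeasurableSpace (α × β)) := by
  refine le_antisymm (iSup_le fun n => (measurable_binaryCodeProd n).comap_le) ?_
  refine sup_le ?_ ?_
  · refine (MeasurableSpace.comap_mono le_iSup_comap_binaryCode).trans ?_
    rw [MeasurableSpace.comap_iSup]
    refine iSup_mono fun n => ?_
    rw [MeasurableSpace.comap_comp]
    exact (measurable_fst.comp (comap_measurable
      (binaryCodeProd n : α × β → (Fin n → Bool) × (Fin n → Bool)))).comap_le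
  · refine (MeasurableSpace.comap_mono le_iSup_comap_binaryCode).trans ?_
    rw [MeasurableSpace.comap_iSup]
    refine iSup_mono fun n => ?_
    rw [MeasurableSpace.comap_comp]
    exact (measurable_snd.comp (comap_measurable
      (binaryCodeProd n : α × β → (Fin n → Bool) × (Fin n → Bool)))).comap_le

end BinaryCode

/-! ### Fatou's lemma for mixed norms -/

/-- In a second countable space every open set is a countable union of balls, whose preimages are
measurable by hypothesis. -/
theorem stronglyMeasurable_of_measurable_dist {α E : Type*} {mα : MeasurableSpace α}
    [PseudoMetricSpace E] [SecondCountableTopology E] {f : α → E}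
    (hf : ∀ y, Measurable fun x => dist (f x) y) : StronglyMeasurable f := by
  let _ : MeasurableSpace E := borel E
  have : BorelSpace E := ⟨rfl⟩
  refine Measurable.stronglyMeasurable (measurable_of_isOpen fun U hU => ?_)
  choose! r hr hrU using fun y (hy : y ∈ U) => Metric.isOpen_iff.1 hU y hy
  obtain ⟨T, hT, hTU⟩ := TopologicalSpace.isOpen_iUnion_countable
    (fun y : U => Metric.ball (y : E) (r y)) fun y => Metric.isOpen_ball
  have hU' : U = ⋃ y ∈ T, Metric.ball (y : E) (r y) := by
    rw [hTU]
    refine Set.Subset.antisymm (fun y hy => ?_) (Set.iUnion_subset fun y => hrU y y.2)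
    exact Set.mem_iUnion.2 ⟨⟨y, hy⟩, Metric.mem_ball_self (hr y hy)⟩
  rw [hU', Set.preimage_iUnion₂]
  refine MeasurableSet.biUnion hT fun y _ => ?_
  exact measurableSet_lt (hf y) measurable_const

/-- Fatou's lemma for `L_q` seminorms of `[0, ∞]`-valued functions. -/
theorem eLpNorm_liminf_le {α : Type*} {mα : MeasurableSpace α} {μ : Measure α} {q : ℝ≥0∞}
    (hq : q ≠ 0) {u : ℕ → α → ℝ≥0∞} (hu : ∀ n, Measurable (u n)) {C : ℝ≥0∞}
    (hC : ∀ n, eLpNorm (u n) q μ ≤ C) :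
    eLpNorm (fun s => liminf (fun n => u n s) atTop) q μ ≤ C := by
  by_cases hq' : q = ∞
  · subst hq'
    simp only [eLpNorm_exponent_top] at hC ⊢
    have h : ∀ᵐ s ∂μ, ∀ n, u n s ≤ C := ae_all_iff.2 fun n => by
      filter_upwards [enorm_ae_le_eLpNormEssSup (u n) μ] with s hs using hs.trans (hC n)
    refine essSup_le_of_ae_le _ ?_
    filter_upwards [h] with s hs
    rw [enorm_eq_self]
    exact liminf_le_of_frequently_le' (Frequently.of_forall hs)
  · have hr : 0 < q.toReal := ENNReal.toReal_pos hq hq'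
    have hint : ∀ n, ∫⁻ s, u n s ^ q.toReal ∂μ ≤ C ^ q.toReal := fun n => by
      have := hC n
      rw [eLpNorm_eq_lintegral_rpow_enorm_toReal hq hq'] at this
      rw [one_div, ENNReal.rpow_inv_le_iff hr] at this
      simpa using this
    rw [eLpNorm_eq_lintegral_rpow_enorm_toReal hq hq', one_div, ENNReal.rpow_inv_le_iff hr]
    have h1 : ∀ s, ‖liminf (fun n => u n s) atTop‖ₑ ^ q.toReal =
        liminf (fun n => u n s ^ q.toReal) atTop := fun s => by
      rw [enorm_eq_self]
      exact (ENNReal.orderIsoRpow q.toReal hr).liminf_apply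
    simp only [h1]
    refine (lintegral_liminf_le fun n => (hu n).pow_const _).trans ?_
    exact liminf_le_of_frequently_le' (Frequently.of_forall hint)

section Sections

variable {α β E : Type*} {mα : MeasurableSpace α} {mβ : MeasurableSpace β} {ν : Measure β}
  [SFinite ν] [NormedAddCommGroup E] {p : ℝ≥0∞}

theorem measurable_eLpNorm_section (hp0 : p ≠ 0) (hp : p ≠ ∞) {h : α × β → E}
    (hh : StronglyMeasurable h) : Measurable fun s => eLpNorm (fun t => h (s, t)) p ν := by
  simp only [eLpNorm_eq_lintegral_rpow_enorm_toReal hp0 hp]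
  exact ((hh.enorm.pow_const _).lintegral_prod_right').pow_const _

open Classical in
/-- The sections of a function on a product, as elements of `L_p`. -/
noncomputable def sectionLp (p : ℝ≥0∞) (ν : Measure β) (h : α × β → E) (s : α) : Lp E p ν :=
  if hs : MemLp (fun t => h (s, t)) p ν then hs.toLp else 0

/-- For p < ∞ the space L_p is separable, so measurability of the distances to fixed elements is
enough. These distances are measurable by Tonelli's theorem. -/
theorem stronglyMeasurable_sectionLp [Fact (1 ≤ p)] (hp : p ≠ ∞) [IsSeparable ν]
    [TopologicalSpace.SeparableSpace E] {h : α × β → E} (hh : StronglyMeasurable h) :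
    StronglyMeasurable (sectionLp p ν h) := by
  have hp0 : p ≠ 0 := (zero_lt_one.trans_le (Fact.out : 1 ≤ p)).ne'
  have : Fact (p ≠ ∞) := ⟨hp⟩
  refine stronglyMeasurable_of_measurable_dist fun g => ?_
  have hset : MeasurableSet {s | MemLp (fun t => h (s, t)) p ν} := by
    have : {s | MemLp (fun t => h (s, t)) p ν} = {s | eLpNorm (fun t => h (s, t)) p ν < ∞} := by
      ext s
      exact ⟨fun hs => hs.2, fun hs =>
        ⟨(hh.comp_measurable measurable_prodMk_left).aestronglyMeasurable, hs⟩⟩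
    rw [this]
    exact measurableSet_lt (measurable_eLpNorm_section hp0 hp hh) measurable_const
  have hg : StronglyMeasurable fun z : α × β => h z - g z.2 :=
    hh.sub ((Lp.stronglyMeasurable g).comp_measurable measurable_snd)
  classical
  have heq : (fun s => dist (sectionLp p ν h s) g) = fun s =>
      if MemLp (fun t => h (s, t)) p ν then (eLpNorm (fun t => h (s, t) - g t) p ν).toReal
      else dist 0 g := by
    ext s
    unfold sectionLp
    split_ifs with hs
    · rw [Lp.dist_def]
      congr 1
      refine eLpNorm_congr_ae ?_
      filter_upwards [hs.coeFn_toLp] with t ht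
      simp [ht]
    · rfl
  rw [heq]
  exact Measurable.ite hset (measurable_eLpNorm_section hp0 hp hg).ennreal_toReal measurable_const

/-- Fatou's lemma for mixed norms: an almost everywhere limit of functions on a product that are
bounded in `L_q(L_p)` represents an element of `L_q(L_p)`. -/
theorem exists_lp_lp_of_tendsto {μ : Measure α} [IsProbabilityMeasure μ] [IsSeparable ν]
    [TopologicalSpace.SeparableSpace E] {q : ℝ≥0∞} [Fact (1 ≤ p)] [Fact (1 ≤ q)] (hp : p ≠ ∞)
    {u : ℕ → α × β → E} (hu : ∀ n, StronglyMeasurable (u n)) {h : α × β → E}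
    (hm : StronglyMeasurable h)
    (ht : ∀ᵐ z ∂(μ.prod ν), Tendsto (fun n => u n z) atTop (𝓝 (h z))) {C : ℝ≥0∞} (hC : C ≠ ∞)
    (huC : ∀ n, eLpNorm (fun s => eLpNorm (fun t => u n (s, t)) p ν) q μ ≤ C) :
    ∃ f : Lp (Lp E p ν) q μ, (∀ᵐ s ∂μ, ∀ᵐ t ∂ν, f s t = h (s, t)) ∧ ‖f‖ₑ ≤ C := by
  have hp0 : p ≠ 0 := (zero_lt_one.trans_le (Fact.out : 1 ≤ p)).ne'
  have hq0 : q ≠ 0 := (zero_lt_one.trans_le (Fact.out : 1 ≤ q)).ne'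
  have ht' := Measure.ae_ae_of_ae_prod ht
  set v : ℕ → α → ℝ≥0∞ := fun n s => eLpNorm (fun t => u n (s, t)) p ν with hv
  have hvm : ∀ n, Measurable (v n) := fun n => measurable_eLpNorm_section hp0 hp (hu n)
  have hfatou : eLpNorm (fun s => liminf (fun n => v n s) atTop) q μ ≤ C :=
    eLpNorm_liminf_le hq0 hvm huC
  have hlm : Measurable fun s => liminf (fun n => v n s) atTop := .liminf hvm
  -- On a probability space the L_q bound controls the integral of the liminf, which is therefore
  -- finite almost everywhere.
  have hfin : ∀ᵐ s ∂μ, liminf (fun n => v n s) atTop < ∞ := by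
    refine ae_lt_top hlm (ne_top_of_le_ne_top hC (le_trans ?_ hfatou))
    refine le_trans (le_of_eq ?_)
      (eLpNorm_le_eLpNorm_of_exponent_le (Fact.out : 1 ≤ q) hlm.aestronglyMeasurable)
    simp [eLpNorm_one_eq_lintegral_enorm]
  have hle : ∀ᵐ s ∂μ, eLpNorm (fun t => h (s, t)) p ν ≤ liminf (fun n => v n s) atTop := by
    filter_upwards [ht'] with s hs
    exact Lp.eLpNorm_lim_le_liminf_eLpNorm
      (fun n => ((hu n).comp_measurable measurable_prodMk_left).aestronglyMeasurable) _ hs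
  have hmem : ∀ᵐ s ∂μ, MemLp (fun t => h (s, t)) p ν := by
    filter_upwards [hfin, hle] with s h1 h2
    exact ⟨(hm.comp_measurable measurable_prodMk_left).aestronglyMeasurable, h2.trans_lt h1⟩
  have hsec : eLpNorm (sectionLp p ν h) q μ ≤ C := by
    refine le_trans (eLpNorm_mono_enorm_ae ?_) hfatou
    filter_upwards [hmem, hle] with s h1 h2
    rw [sectionLp, dif_pos h1, Lp.enorm_toLp, enorm_eq_self]
    exact h2
  have hsecm : MemLp (sectionLp p ν h) q μ :=
    ⟨(stronglyMeasurable_sectionLp hp hm).aestronglyMeasurable, hsec.trans_lt hC.lt_top⟩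
  refine ⟨hsecm.toLp, ?_, by rwa [Lp.enorm_toLp]⟩
  filter_upwards [hsecm.coeFn_toLp, hmem] with s h1 h2
  rw [h1, sectionLp, dif_pos h2]
  exact h2.coeFn_toLp

end Sections

/-! ### The set function of a bidual element on rectangles -/

section Rect

variable {α β 𝕜 K L : Type*} [RCLike 𝕜] [Fintype K] [MeasurableSpace K]
  [MeasurableSingletonClass K] [Fintype L] [MeasurableSpace L] [MeasurableSingletonClass L]
  {mα : MeasurableSpace α} {mβ : MeasurableSpace β} {μ : Measure α} {ν : Measure β}
  [IsProbabilityMeasure μ] [IsProbabilityMeasure ν] {p q : ℝ≥0∞} [Fact (1 ≤ p)] [Fact (1 ≤ q)]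

omit [Fintype K] [MeasurableSpace K] [MeasurableSingletonClass K] [Fintype L]
  [MeasurableSpace L] [MeasurableSingletonClass L] in
theorem prodMk_preimage_singleton (c : α → K) (d : β → L) (k : K × L) :
    (fun z : α × β => (c z.1, d z.2)) ⁻¹' {k} = (c ⁻¹' {k.1}) ×ˢ (d ⁻¹' {k.2}) := by
  ext z; simp [Prod.ext_iff]

omit [Fintype K] [Fintype L] in
theorem cellDensity_prod_eq_rectDensity {c : α → K} (hc : Measurable c) {d : β → L}
    (hd : Measurable d) (x : StrongDual 𝕜 (StrongDual 𝕜 (Lp (Lp 𝕜 p ν) q μ))) (z : α × β) :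
    cellDensity (μ.prod ν) (fun z : α × β => (c z.1, d z.2))
      (fun k => x (rectIntegral μ ν p q 𝕜 hc hd k.1 k.2)) z =
      rectDensity μ ν p q hc hd x (c z.1) (d z.2) := by
  rw [cellDensity, rectDensity, prodMk_preimage_singleton, measureReal_prod_prod,
    RCLike.real_smul_eq_coe_mul, mul_inv]

omit [Fintype K] [Fintype L] in
theorem rectIntegral_apply {c : α → K} (hc : Measurable c) {d : β → L} (hd : Measurable d) (k : K)
    (l : L) (f : Lp (Lp 𝕜 p ν) q μ) : rectIntegral μ ν p q 𝕜 hc hd k l f =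
      ∫ t in d ⁻¹' {l}, (∫ s in c ⁻¹' {k}, f s ∂μ : Lp 𝕜 p ν) t ∂ν := by
  rw [rectIntegral, ContinuousLinearMap.comp_apply, cellIntegral_apply, cellIntegral_apply]

omit [Fintype K] [Fintype L] in
theorem rectIntegral_eq_zero {c : α → K} (hc : Measurable c) {d : β → L} (hd : Measurable d)
    {k : K × L} (h : (μ.prod ν) ((fun z : α × β => (c z.1, d z.2)) ⁻¹' {k}) = 0) :
    rectIntegral μ ν p q 𝕜 hc hd k.1 k.2 = 0 := by
  rw [prodMk_preimage_singleton, Measure.prod_prod, mul_eq_zero] at h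
  ext f
  rw [rectIntegral, ContinuousLinearMap.comp_apply, zero_apply]
  rcases h with h | h
  · rw [cellIntegral_apply 𝕜 hc, Measure.restrict_eq_zero.2 h, integral_zero_measure, map_zero]
  · rw [cellIntegral_apply 𝕜 hd, Measure.restrict_eq_zero.2 h, integral_zero_measure]

omit [Fintype K] in
theorem cellIntegral_eq_sum {E K' : Type*} [NormedAddCommGroup E] [NormedSpace ℝ E]
    [NormedSpace 𝕜 E] [SMulCommClass ℝ 𝕜 E] [Fintype K'] [MeasurableSpace K']
    [MeasurableSingletonClass K'] [DecidableEq K] {c : α → K} (hc : Measurable c) {c' : α → K'}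
    (hc' : Measurable c') {π : K' → K} (hπ : ∀ x, π (c' x) = c x) (k : K) :
    (cellIntegral 𝕜 hc k : Lp E q μ →L[𝕜] E) = ∑ k' with π k' = k, cellIntegral 𝕜 hc' k' := by
  ext f
  rw [sum_apply]
  simp only [cellIntegral_apply]
  rw [← setIntegral_preimage_eq_sum hc' _ (Lp.integrable_coeFn f)]
  congr 2
  ext x; simp [hπ]

omit [Fintype K] [Fintype L] in
theorem rectIntegral_eq_sum {K' L' : Type*} [Fintype K'] [MeasurableSpace K']
    [MeasurableSingletonClass K'] [DecidableEq K] [Fintype L'] [MeasurableSpace L']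
    [MeasurableSingletonClass L'] [DecidableEq L] {c : α → K} (hc : Measurable c) {c' : α → K'}
    (hc' : Measurable c') {π : K' → K} (hπ : ∀ x, π (c' x) = c x) {d : β → L} (hd : Measurable d)
    {d' : β → L'} (hd' : Measurable d') {ρ : L' → L} (hρ : ∀ x, ρ (d' x) = d x) (k : K × L) :
    rectIntegral μ ν p q 𝕜 hc hd k.1 k.2 =
      ∑ k' : K' × L' with (π k'.1, ρ k'.2) = k, rectIntegral μ ν p q 𝕜 hc' hd' k'.1 k'.2 := by
  have hfil : (Finset.univ.filter fun k' : K' × L' => (π k'.1, ρ k'.2) = k) =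
      (Finset.univ.filter fun k' => π k' = k.1) ×ˢ (Finset.univ.filter fun l' => ρ l' = k.2) := by
    ext k'; simp [Prod.ext_iff]
  rw [hfil, Finset.sum_product]
  ext f
  simp only [rectIntegral, cellIntegral_eq_sum hc hc' hπ, cellIntegral_eq_sum hd hd' hρ,
    ContinuousLinearMap.comp_apply, sum_apply, map_sum]

/-- Both measures have mass 1, so the mixed norm dominates the L_1 norm on the product. This is the
bound that Doob's convergence theorem needs. -/
theorem eLpNorm_one_rectDensity_le (hp : p ≠ ∞) {c : α → K} (hc : Measurable c) {d : β → L}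
    (hd : Measurable d) (x : StrongDual 𝕜 (StrongDual 𝕜 (Lp (Lp 𝕜 p ν) q μ))) :
    eLpNorm (fun z : α × β => rectDensity μ ν p q hc hd x (c z.1) (d z.2)) 1 (μ.prod ν) ≤
      ‖x‖ₑ := by
  have hp0 : p ≠ 0 := (zero_lt_one.trans_le (Fact.out : 1 ≤ p)).ne'
  have hm : StronglyMeasurable
      fun z : α × β => rectDensity μ ν p q hc hd x (c z.1) (d z.2) :=
    ((Measurable.of_discrete (f := fun k : K × L => rectDensity μ ν p q hc hd x k.1 k.2)).comp
      ((hc.comp measurable_fst).prodMk (hd.comp measurable_snd))).stronglyMeasurable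
  rw [eLpNorm_one_eq_lintegral_enorm, lintegral_prod _ hm.enorm.aemeasurable]
  calc _ ≤ ∫⁻ s, eLpNorm (fun t => rectDensity μ ν p q hc hd x (c s) (d t)) p ν ∂μ := by
        refine lintegral_mono fun s => ?_
        rw [← eLpNorm_one_eq_lintegral_enorm]
        exact eLpNorm_le_eLpNorm_of_exponent_le Fact.out
          (hm.comp_measurable measurable_prodMk_left).aestronglyMeasurable
    _ = eLpNorm (fun s => eLpNorm (fun t => rectDensity μ ν p q hc hd x (c s) (d t)) p ν) 1 μ := by
        simp [eLpNorm_one_eq_lintegral_enorm]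
    _ ≤ eLpNorm (fun s => eLpNorm (fun t => rectDensity μ ν p q hc hd x (c s) (d t)) p ν) q μ :=
        eLpNorm_le_eLpNorm_of_exponent_le Fact.out
          (measurable_eLpNorm_section hp0 hp hm).aestronglyMeasurable
    _ ≤ _ := eLpNorm_eLpNorm_rectDensity_le hc hd x

end Rect

/-! ### The projection onto almost everywhere densities -/

section Projection

open MeasurableSpace

variable {α β 𝕜 : Type*} [RCLike 𝕜] [MeasurableSpace α] [MeasurableSpace β]
  [CountablyGenerated α] [CountablyGenerated β] {μ : Measure α} {ν : Measure β}
  [IsProbabilityMeasure μ] [IsProbabilityMeasure ν] {p q : ℝ≥0∞} [Fact (1 ≤ p)] [Fact (1 ≤ q)]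

/-- The density martingale of a bidual element of `L_q(L_p)`. -/
noncomputable def densityMartingale (x : StrongDual 𝕜 (StrongDual 𝕜 (Lp (Lp 𝕜 p ν) q μ))) (n : ℕ)
    (s : α) (t : β) : 𝕜 :=
  rectDensity μ ν p q (measurable_binaryCode n) (measurable_binaryCode n) x (binaryCode n s)
    (binaryCode n t)

/-- The densities of the bidual element `x` converge almost everywhere to `f`. -/
def HasDensity (x : StrongDual 𝕜 (StrongDual 𝕜 (Lp (Lp 𝕜 p ν) q μ)))
    (f : Lp (Lp 𝕜 p ν) q μ) : Prop :=
  ∀ᵐ s ∂μ, ∀ᵐ t ∂ν, Tendsto (fun n => densityMartingale x n s t) atTop (𝓝 (f s t))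

theorem cellDensity_binaryCodeProd (x : StrongDual 𝕜 (StrongDual 𝕜 (Lp (Lp 𝕜 p ν) q μ))) (n : ℕ)
    (z : α × β) :
    cellDensity (μ.prod ν) (binaryCodeProd n) (fun k => x (rectIntegral μ ν p q 𝕜
      (measurable_binaryCode n) (measurable_binaryCode n) k.1 k.2)) z =
      densityMartingale x n z.1 z.2 :=
  cellDensity_prod_eq_rectDensity (measurable_binaryCode n) (measurable_binaryCode n) x z

theorem stronglyMeasurable_densityMartingale
    (x : StrongDual 𝕜 (StrongDual 𝕜 (Lp (Lp 𝕜 p ν) q μ))) (n : ℕ) :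
    StronglyMeasurable fun z : α × β => densityMartingale x n z.1 z.2 :=
  ((Measurable.of_discrete (f := fun k : (Fin n → Bool) × (Fin n → Bool) => rectDensity μ ν p q
    (measurable_binaryCode n) (measurable_binaryCode n) x k.1 k.2)).comp
      (measurable_binaryCodeProd n)).stronglyMeasurable

theorem exists_tendsto_densityMartingale (hp : p ≠ ∞)
    (x : StrongDual 𝕜 (StrongDual 𝕜 (Lp (Lp 𝕜 p ν) q μ))) :
    ∃ h : α × β → 𝕜, Measurable h ∧ ∀ᵐ z ∂(μ.prod ν),
      Tendsto (fun n => densityMartingale x n z.1 z.2) atTop (𝓝 (h z)) := by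
  have h := exists_tendsto_cellDensity (μ := μ.prod ν) (c := fun n => binaryCodeProd n)
    (π := truncProd) measurable_binaryCodeProd truncProd_binaryCodeProd
    (m := fun n k => x (rectIntegral μ ν p q 𝕜
      (measurable_binaryCode n) (measurable_binaryCode n) k.1 k.2)) (R := ‖x‖₊) ?_ ?_ ?_
  · simpa only [cellDensity_binaryCodeProd] using h
  · intro n k
    rw [← map_sum]
    congr 1
    exact rectIntegral_eq_sum (measurable_binaryCode n) (measurable_binaryCode (n + 1))
      (π := fun k i => k i.castSucc) (fun _ => rfl) (measurable_binaryCode n)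
      (measurable_binaryCode (n + 1)) (ρ := fun k i => k i.castSucc) (fun _ => rfl) k
  · intro n k hk
    rw [rectIntegral_eq_zero (measurable_binaryCode n) (measurable_binaryCode n) hk, map_zero]
  · intro n
    refine le_trans (le_of_eq (eLpNorm_congr_ae (Eventually.of_forall fun z =>
      cellDensity_binaryCodeProd x n z))) ?_
    exact eLpNorm_one_rectDensity_le hp (measurable_binaryCode n) (measurable_binaryCode n) x

theorem exists_hasDensity (hp : p ≠ ∞) (x : StrongDual 𝕜 (StrongDual 𝕜 (Lp (Lp 𝕜 p ν) q μ))) :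
    ∃ f, HasDensity x f ∧ ‖f‖ ≤ ‖x‖ := by
  obtain ⟨h, hm, ht⟩ := exists_tendsto_densityMartingale hp x
  obtain ⟨f, hf, hfn⟩ := exists_lp_lp_of_tendsto (q := q) hp
    (stronglyMeasurable_densityMartingale x) hm.stronglyMeasurable ht (enorm_ne_top (x := x)) fun n =>
      eLpNorm_eLpNorm_rectDensity_le (measurable_binaryCode n) (measurable_binaryCode n) x
  refine ⟨f, ?_, enorm_le_iff_norm_le.1 hfn⟩
  filter_upwards [hf, Measure.ae_ae_of_ae_prod ht] with s h1 h2
  filter_upwards [h1, h2] with t h3 h4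
  rwa [h3]

/-- Uniqueness makes the passage to the density linear, and reduces the projection identity to
showing that f is a density of its own image in the bidual. -/
theorem HasDensity.unique {x : StrongDual 𝕜 (StrongDual 𝕜 (Lp (Lp 𝕜 p ν) q μ))}
    {f g : Lp (Lp 𝕜 p ν) q μ} (hf : HasDensity x f) (hg : HasDensity x g) : f = g := by
  refine Lp.ext ?_
  filter_upwards [hf, hg] with s h1 h2
  refine Lp.ext ?_
  filter_upwards [h1, h2] with t h3 h4 using tendsto_nhds_unique h3 h4

theorem HasDensity.add {x y : StrongDual 𝕜 (StrongDual 𝕜 (Lp (Lp 𝕜 p ν) q μ))}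
    {f g : Lp (Lp 𝕜 p ν) q μ} (hf : HasDensity x f) (hg : HasDensity y g) :
    HasDensity (x + y) (f + g) := by
  filter_upwards [hf, hg, Lp.coeFn_add f g] with s h1 h2 hs
  rw [hs, Pi.add_apply]
  filter_upwards [h1, h2, Lp.coeFn_add (f s) (g s)] with t h3 h4 ht
  rw [ht, Pi.add_apply]
  refine (h3.add h4).congr fun n => ?_
  simp only [densityMartingale, rectDensity, add_apply, mul_add]

theorem HasDensity.smul (c : 𝕜) {x : StrongDual 𝕜 (StrongDual 𝕜 (Lp (Lp 𝕜 p ν) q μ))}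
    {f : Lp (Lp 𝕜 p ν) q μ} (hf : HasDensity x f) : HasDensity (c • x) (c • f) := by
  filter_upwards [hf, Lp.coeFn_smul c f] with s h1 hs
  rw [hs, Pi.smul_apply]
  filter_upwards [h1, Lp.coeFn_smul c (f s)] with t h3 ht
  rw [ht, Pi.smul_apply]
  refine (h3.const_smul c).congr fun n => ?_
  simp only [densityMartingale, rectDensity, smul_apply, smul_eq_mul, mul_left_comm]

/-- The contraction from the bidual of `L_q(L_p)` to `L_q(L_p)` that maps a bidual element to its
almost everywhere density. -/
theorem exists_bidual_density_map (hp : p ≠ ∞) :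
    ∃ P : StrongDual 𝕜 (StrongDual 𝕜 (Lp (Lp 𝕜 p ν) q μ)) →L[𝕜] Lp (Lp 𝕜 p ν) q μ,
      ∀ x, HasDensity x (P x) := by
  choose P hP hPn using exists_hasDensity (𝕜 := 𝕜) (μ := μ) (ν := ν) (p := p) (q := q) hp
  exact ⟨LinearMap.mkContinuous
    { toFun := P
      map_add' := fun x y => (hP (x + y)).unique ((hP x).add (hP y))
      map_smul' := fun c x => (hP (c • x)).unique ((hP x).smul c) } 1
      fun x => by simpa using hPn x, hP⟩

set_option maxHeartbeats 2000000 in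
theorem hasDensity_indicatorConst {A : Set α} (hA : MeasurableSet A) (g : Lp 𝕜 p ν) :
    HasDensity (NormedSpace.inclusionInDoubleDual 𝕜 (Lp (Lp 𝕜 p ν) q μ)
      (indicatorConstLp q hA (measure_ne_top μ A) g)) (indicatorConstLp q hA
        (measure_ne_top μ A) g) := by
  set f : Lp (Lp 𝕜 p ν) q μ := indicatorConstLp q hA (measure_ne_top μ A) g with hf
  -- The element is represented by the jointly measurable function 1_A(s) g(t), so Lévy's theorem on
  -- the product applies once the cell integrals are matched.
  have hF : Integrable (fun z : α × β => A.indicator (fun _ => (1 : 𝕜)) z.1 * g z.2)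
      (μ.prod ν) :=
    ((integrable_const (1 : 𝕜)).indicator hA).mul_prod (Lp.integrable_coeFn g)
  have h := tendsto_cellDensity_of_integral (μ := μ.prod ν) (c := fun n => binaryCodeProd n)
    (π := truncProd) measurable_binaryCodeProd truncProd_binaryCodeProd iSup_comap_binaryCodeProd
    hF (m := fun n k => NormedSpace.inclusionInDoubleDual 𝕜 _ f (rectIntegral μ ν p q 𝕜
      (measurable_binaryCode n) (measurable_binaryCode n) k.1 k.2)) ?_
  · filter_upwards [Measure.ae_ae_of_ae_prod h, indicatorConstLp_coeFn (p := q) (hs := hA)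
      (hμs := measure_ne_top μ A) (c := g)] with s hs hfs
    rw [hfs]
    by_cases hsA : s ∈ A
    · filter_upwards [hs] with t ht
      simpa only [cellDensity_binaryCodeProd, Set.indicator_of_mem hsA, one_mul] using ht
    · filter_upwards [hs, Lp.coeFn_zero 𝕜 p ν] with t ht h0
      rw [Set.indicator_of_notMem hsA, h0, Pi.zero_apply]
      simpa only [cellDensity_binaryCodeProd, Set.indicator_of_notMem hsA, zero_mul] using ht
  · intro n k
    have hI : MeasurableSet ((binaryCode n : α → Fin n → Bool) ⁻¹' {k.1}) :=
      measurable_binaryCode n (measurableSet_singleton _)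
    have h1 : (∫ s in (binaryCode n) ⁻¹' {k.1}, f s ∂μ : Lp 𝕜 p ν) =
        (∫ s in (binaryCode n) ⁻¹' {k.1}, A.indicator (fun _ => (1 : 𝕜)) s ∂μ) • g := by
      rw [← integral_smul_const]
      refine setIntegral_congr_ae hI ?_
      filter_upwards [indicatorConstLp_coeFn (p := q) (hs := hA) (hμs := measure_ne_top μ A)
        (c := g)] with s hs _
      rw [hf, hs]
      by_cases hsA : s ∈ A <;> simp [hsA]
    rw [NormedSpace.dual_def, rectIntegral_apply, h1]
    have hset : (binaryCodeProd n : α × β → _) ⁻¹' {k} =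
        (binaryCode n ⁻¹' {k.1}) ×ˢ (binaryCode n ⁻¹' {k.2}) :=
      prodMk_preimage_singleton _ _ k
    rw [hset, setIntegral_prod_mul, ← integral_const_mul]
    refine integral_congr_ae (ae_restrict_of_ae ?_)
    filter_upwards [Lp.coeFn_smul
      (∫ s in (binaryCode n) ⁻¹' {k.1}, A.indicator (fun _ => (1 : 𝕜)) s ∂μ) g] with t ht
    rw [ht, Pi.smul_apply, smul_eq_mul]

-- The set where P ∘ J is the identity is a closed subspace, and the elements 1_A g span a dense
-- subspace because the outer exponent 1 is finite.
set_option maxHeartbeats 2000000 in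
theorem hasDensity_inclusion_one (hp : p ≠ ∞) (f : Lp (Lp 𝕜 p ν) 1 μ) :
    HasDensity (NormedSpace.inclusionInDoubleDual 𝕜 _ f) f := by
  obtain ⟨P, hP⟩ := exists_bidual_density_map (𝕜 := 𝕜) (μ := μ) (ν := ν) (p := p) (q := 1) hp
  suffices h : P (NormedSpace.inclusionInDoubleDual 𝕜 _ f) = f by
    have := hP (NormedSpace.inclusionInDoubleDual 𝕜 _ f)
    rwa [h] at this
  induction f using Lp.induction (p := 1) ENNReal.one_ne_top with
  | indicatorConst g hs hμs => exact (hP _).unique (hasDensity_indicatorConst hs g)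
  | add hf hg _ h1 h2 => rw [map_add, map_add, h1, h2]
  | isClosed =>
    exact isClosed_eq (P.continuous.comp (ContinuousLinearMap.continuous _)) continuous_id

-- For q = ∞ the density argument in L_q breaks down. However, the densities of J f depend only on
-- integrals of f over rectangles, so f may be regarded as an element of L_1(L_p).
set_option maxHeartbeats 2000000 in
theorem hasDensity_inclusion (hp : p ≠ ∞) (f : Lp (Lp 𝕜 p ν) q μ) :
    HasDensity (NormedSpace.inclusionInDoubleDual 𝕜 _ f) f := by
  have hmem : MemLp f 1 μ := (Lp.memLp f).mono_exponent Fact.out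
  have hg := hmem.coeFn_toLp
  have hden : ∀ n s t, densityMartingale (NormedSpace.inclusionInDoubleDual 𝕜 _ hmem.toLp) n s t =
      densityMartingale (NormedSpace.inclusionInDoubleDual 𝕜 _ f) n s t := fun n s t => by
    rw [densityMartingale, densityMartingale, rectDensity, rectDensity, NormedSpace.dual_def,
      NormedSpace.dual_def, rectIntegral_apply, rectIntegral_apply]
    congr 3
    rw [integral_congr_ae (ae_restrict_of_ae hg)]
  filter_upwards [hasDensity_inclusion_one hp hmem.toLp, hg] with s hs hgs
  rw [← hgs]
  simpa only [hden] using hs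

end Projection

/-- For `p < ∞`, the mixed-norm space `L_q(L_p)` over countably generated probability spaces is
complemented in its bidual. -/
theorem isComplementedInBidual_lp_lp {α β 𝕜 : Type*} [RCLike 𝕜] [MeasurableSpace α]
    [MeasurableSpace β] [MeasurableSpace.CountablyGenerated α]
    [MeasurableSpace.CountablyGenerated β] {μ : Measure α} {ν : Measure β}
    [IsProbabilityMeasure μ] [IsProbabilityMeasure ν] {p q : ℝ≥0∞} [Fact (1 ≤ p)] [Fact (1 ≤ q)]
    (hp : p ≠ ∞) : IsComplementedInBidual 𝕜 (Lp (Lp 𝕜 p ν) q μ) := by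
  obtain ⟨P, hP⟩ := exists_bidual_density_map (𝕜 := 𝕜) (μ := μ) (ν := ν) (p := p) (q := q) hp
  exact ⟨P, fun f => (hP _).unique (hasDensity_inclusion hp f)⟩

theorem theorem2p7 (𝕜 : Type*) [RCLike 𝕜] (p q : ℝ≥0∞) [Fact (1 ≤ p)] [Fact (1 ≤ q)]
    (hpq : p ≠ q) :
    IsComplementedInBidual 𝕜 (MixedLp 𝕜 p q) ↔ p < ∞ := by
  refine ⟨fun h => ?_, fun hp => isComplementedInBidual_lp_lp hp.ne⟩
  by_contra hp
  obtain rfl : p = ∞ := not_lt_top_iff.1 hp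
  -- With p = ∞, the assumption p ≠ q supplies the finiteness of q.
  exact not_isComplementedInBidual_mixedLp_top 𝕜 q hpq.symm h
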